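/- Let $\Lambda$ and $\Gamma$ be (not necessarily commutative) rings that are both left and right Noetherian. Modules are left modules, and right $\Lambda$-modules are modules over $\Lambda^{\mathrm{op}}$. For a $\Lambda$-module $X$, the strong grade $\operatorname{sgrade} X$ is the infimum (possibly $\infty$) of all $n\ge 0$ such that $\operatorname{Ext}^n_\Lambda(N,\Lambda)\neq 0$ for some submodule $N\subseteq X$. The ring $\Lambda$ satisfies the $(l,n)$-condition if $\operatorname{sgrade}\operatorname{Ext}^l_{\Lambda^{\mathrm{op}}}(X,\Lambda)\ge n$ for every finitely generated $\Lambda^{\mathrm{op}}$-module $X$ (equivalently, the first $n$ terms $I^0,\dots,I^{n-1}$ of the minimal injective resolution of $\Lambda$ in the category of $\Lambda$-modules have flat dimension less than $l$). It satisfies the two-sided $(l,n)$-condition if both $\Lambda$ and $\Lambda^{\mathrm{op}}$ satisfy the $(l,n)$-condition. Let $\operatorname{refl}\Lambda$ be the full subcategory of the category of $\Lambda$-modules consisting of the finitely generated modules $X$ whose evaluation map $X\to \operatorname{Hom}_{\Lambda^{\mathrm{op}}}(\operatorname{Hom}_\Lambda(X,\Lambda),\Lambda)$ is an isomorphism. Given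 an exact structure (in the sense of Quillen) on an additive category $\mathcal C$, an object $M\in\mathcal C$ is a generator-cogenerator if every object of $\mathcal C$ admits an admissible epimorphism from an object of $\operatorname{add}M$ and an admissible monomorphism into an object of $\operatorname{add}M$, where $\operatorname{add}M$ consists of the direct summands of finite direct sums of copies of $M$. The maximum exact structure on $\mathcal C$ is the exact structure that contains all the others. The elements of $\operatorname{End}_\Lambda(M)$ are written on the side opposite to the scalars, so that a product $fg$ in $\operatorname{End}_\Lambda(M)$ means first $f$, then $g$ (and $\operatorname{End}_\Lambda(\Lambda)\cong\Lambda$ as rings). Suppose that $\Lambda$ satisfies the two-sided $(2,2)$-condition. Then the following are equivalent. 1. There is an equivalence of categories $\operatorname{refl}\Lambda\simeq\operatorname{refl}\Gamma$. 2. The category $\operatorname{refl}\Lambda$ has a maximum exact structure, and there is a generator-cogenerator $M\in\operatorname{refl}\Lambda$ in this exact structure such that $\Gamma\cong\operatorname{End}_\Lambda(M)$ as rings. In this case, $\Gamma$ also satisfies the two-sided $(2,2)$-condition. -/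

import Mathlib

open CategoryTheory CategoryTheory.Limits CategoryTheory.Abelian

universe u v w

noncomputable section

/-! ## Strong grade and the `(l,n)`-conditions

`Λ`-modules are left modules; right `Λ`-modules are modules over `Λᵐᵒᵖ`. -/

section ExtModule

variable (R S : Type u) [Ring R] [Ring S]
  (E : Type u) [AddCommGroup E] [Module R E] [Module S E] [SMulCommClass R S E]

/-- The action of `s : S` on `E`, as an endomorphism of the `R`-module `E`, for commuting
actions of `R` and `S` on `E`. -/
def smulHom (s : S) : ModuleCat.of R E ⟶ ModuleCat.of R E :=
  ModuleCat.ofHom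
    { toFun := fun e => s • e
      map_add' := smul_add s
      map_smul' := fun r e => (smul_comm r s e).symm }

variable (X : ModuleCat.{u} R) (l : ℕ)

/-- The `S`-module structure on `Ext^l_R(X, E)` induced by the `S`-action on `E`. -/
abbrev extModule : Module S (Ext.{u} X (ModuleCat.of R E) l) where
  smul s x := x.comp (Ext.mk₀ (smulHom R S E s)) (add_zero l)
  one_smul x := by
    have h : smulHom R S E 1 = 𝟙 _ := by
      ext e
      exact one_smul S e
    change x.comp (Ext.mk₀ (smulHom R S E 1)) (add_zero l) = x
    rw [h, Ext.comp_mk₀_id]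
  mul_smul s t x := by
    have h : smulHom R S E (s * t) = smulHom R S E t ≫ smulHom R S E s := by
      ext e
      exact mul_smul s t e
    change x.comp (Ext.mk₀ (smulHom R S E (s * t))) (add_zero l) =
      (x.comp (Ext.mk₀ (smulHom R S E t)) (add_zero l)).comp
        (Ext.mk₀ (smulHom R S E s)) (add_zero l)
    rw [h, Ext.comp_assoc_of_third_deg_zero, Ext.mk₀_comp_mk₀]
  smul_zero s := Ext.zero_comp _ _ _ _ _
  smul_add s x y := Ext.add_comp _ _ _ _
  add_smul s t x := by
    have h : smulHom R S E (s + t) = smulHom R S E s + smulHom R S E t := by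
      ext e
      exact add_smul s t e
    change x.comp (Ext.mk₀ (smulHom R S E (s + t))) (add_zero l) =
      x.comp (Ext.mk₀ (smulHom R S E s)) (add_zero l) +
        x.comp (Ext.mk₀ (smulHom R S E t)) (add_zero l)
    rw [h, Ext.mk₀_add, Ext.comp_add]
  zero_smul x := by
    have h : smulHom R S E 0 = 0 := by
      ext e
      exact zero_smul S e
    change x.comp (Ext.mk₀ (smulHom R S E 0)) (add_zero l) = 0
    rw [h, Ext.mk₀_zero, Ext.comp_zero]

/-- `Ext^l_R(X, E)` as an `S`-module. -/
def extObj : ModuleCat.{u} S :=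
  letI := extModule R S E X l
  ModuleCat.of S (Ext.{u} X (ModuleCat.of R E) l)

end ExtModule

/-- The strong grade of a `Λ`-module `X`: the infimum of the `n` such that
`Ext^n_Λ(N, Λ) ≠ 0` for some submodule `N ⊆ X` (and `∞` if there is no such `n`). -/
def sgrade (Λ : Type u) [Ring Λ] (X : ModuleCat.{u} Λ) : ℕ∞ :=
  sInf {m : ℕ∞ | ∃ (n : ℕ) (N : Submodule Λ X), m = n ∧
    Nontrivial (Ext.{u} (ModuleCat.of Λ N) (ModuleCat.of Λ Λ) n)}

/-- The `(l,n)`-condition: for every finitely generated right `Λ`-module `X`, the left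
`Λ`-module `Ext^l(X, Λ)` has strong grade at least `n`. -/
def LNCondition (Λ : Type u) [Ring Λ] (l n : ℕ) : Prop :=
  ∀ X : ModuleCat.{u} Λᵐᵒᵖ, Module.Finite Λᵐᵒᵖ X →
    (n : ℕ∞) ≤ sgrade Λ (extObj Λᵐᵒᵖ Λ Λ X l)

/-- The `(l,n)`-condition on the opposite ring, with right `Λᵐᵒᵖ`-modules written as left
`Λ`-modules: for every finitely generated left `Λ`-module `X`, the right `Λ`-module
`Ext^l(X, Λ)` has strong grade at least `n`. The right module `Λ` over `Λᵐᵒᵖ` is the regular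
module of `Λᵐᵒᵖ`, used in `sgrade`. -/
def LNConditionOp (Λ : Type u) [Ring Λ] (l n : ℕ) : Prop :=
  ∀ X : ModuleCat.{u} Λ, Module.Finite Λ X →
    (n : ℕ∞) ≤ sgrade Λᵐᵒᵖ (extObj Λ Λᵐᵒᵖ Λ X l)

/-- The two-sided `(l,n)`-condition. -/
def TwoSidedLNCondition (Λ : Type u) [Ring Λ] (l n : ℕ) : Prop :=
  LNCondition Λ l n ∧ LNConditionOp Λ l n

/-! ## Reflexive modules -/

/-- The evaluation map `X → Hom_{Λᵐᵒᵖ}(Hom_Λ(X, Λ), Λ)`. -/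
def evalBidual (Λ : Type u) [Ring Λ] (X : Type u) [AddCommGroup X] [Module Λ X] :
    X →ₗ[Λ] ((X →ₗ[Λ] Λ) →ₗ[Λᵐᵒᵖ] Λ) where
  toFun x :=
    { toFun := fun f => f x
      map_add' := fun _ _ => rfl
      map_smul' := fun _ _ => rfl }
  map_add' x y := by
    ext f
    exact f.map_add x y
  map_smul' a x := by
    ext f
    exact f.map_smul a x

/-- Finitely generated modules whose evaluation map into the double dual is bijective. -/
def isReflexiveModule (Λ : Type u) [Ring Λ] : ObjectProperty (ModuleCat.{u} Λ) :=
  fun X => Module.Finite Λ X ∧ Function.Bijective (evalBidual Λ X)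

/-- The category `refl Λ`: the full subcategory of reflexive modules. -/
abbrev Refl (Λ : Type u) [Ring Λ] := (isReflexiveModule Λ).FullSubcategory

/-! ## Exact structures, generators and cogenerators -/

section Exact

variable {C : Type v} [Category.{w} C] [Preadditive C]

/-- `f = ker g` and `g = coker f`. -/
def IsKernelCokernelPair (T : ShortComplex C) : Prop :=
  Nonempty (IsLimit (KernelFork.ofι T.f T.zero)) ∧
    Nonempty (IsColimit (CokernelCofork.ofπ T.g T.zero))

/-- `f` is an admissible monomorphism for the class `𝒮` of conflations. -/
def IsAdmissibleMono (𝒮 : ObjectProperty (ShortComplex C)) {X Y : C} (f : X ⟶ Y) : Prop :=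
  ∃ (Z : C) (g : Y ⟶ Z) (h : f ≫ g = 0), 𝒮 (ShortComplex.mk f g h)

/-- `g` is an admissible epimorphism for the class `𝒮` of conflations. -/
def IsAdmissibleEpi (𝒮 : ObjectProperty (ShortComplex C)) {Y Z : C} (g : Y ⟶ Z) : Prop :=
  ∃ (X : C) (f : X ⟶ Y) (h : f ≫ g = 0), 𝒮 (ShortComplex.mk f g h)

/-- Exact structures in the sense of Quillen on an additive category. -/
structure IsExactStructure (𝒮 : ObjectProperty (ShortComplex C)) : Prop where
  kernelCokernelPair : ∀ T, 𝒮 T → IsKernelCokernelPair T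
  of_iso : ∀ T T' : ShortComplex C, Nonempty (T ≅ T') → 𝒮 T → 𝒮 T'
  id_left : ∀ L Z : C, IsZero Z → 𝒮 (ShortComplex.mk (𝟙 L) (0 : L ⟶ Z) comp_zero)
  id_right : ∀ Z L : C, IsZero Z → 𝒮 (ShortComplex.mk (0 : Z ⟶ L) (𝟙 L) zero_comp)
  comp_mono : ∀ {X Y Z : C} (f : X ⟶ Y) (g : Y ⟶ Z),
    IsAdmissibleMono 𝒮 f → IsAdmissibleMono 𝒮 g → IsAdmissibleMono 𝒮 (f ≫ g)
  comp_epi : ∀ {X Y Z : C} (f : X ⟶ Y) (g : Y ⟶ Z),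
    IsAdmissibleEpi 𝒮 f → IsAdmissibleEpi 𝒮 g → IsAdmissibleEpi 𝒮 (f ≫ g)
  pushout : ∀ (T : ShortComplex C), 𝒮 T → ∀ {L' : C} (a : T.X₁ ⟶ L'),
    ∃ (N' : C) (b : T.X₂ ⟶ N') (f' : L' ⟶ N') (g' : N' ⟶ T.X₃) (h : f' ≫ g' = 0),
      IsPushout T.f a b f' ∧ b ≫ g' = T.g ∧ 𝒮 (ShortComplex.mk f' g' h)
  pullback : ∀ (T : ShortComplex C), 𝒮 T → ∀ {M' : C} (c : M' ⟶ T.X₃),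
    ∃ (N' : C) (b : N' ⟶ T.X₂) (g' : N' ⟶ M') (f' : T.X₁ ⟶ N') (h : f' ≫ g' = 0),
      IsPullback b g' T.g c ∧ f' ≫ b = T.f ∧ 𝒮 (ShortComplex.mk f' g' h)

/-- The maximum exact structure: an exact structure which contains every other one. -/
def IsMaximumExactStructure (𝒮 : ObjectProperty (ShortComplex C)) : Prop :=
  IsExactStructure 𝒮 ∧ ∀ 𝒯 : ObjectProperty (ShortComplex C), IsExactStructure 𝒯 → 𝒯 ≤ 𝒮

/-- `N ∈ add M`: `N` is a direct summand of a finite direct sum of copies of `M`. -/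
def InAdd (M N : C) : Prop :=
  ∃ (n : ℕ) (B : LimitBicone (fun _ : Fin n => M)), Nonempty (Retract N B.bicone.pt)

/-- Every object admits an admissible epimorphism from an object of `add M`, and an admissible
monomorphism into an object of `add M`. -/
def IsGeneratorCogenerator (𝒮 : ObjectProperty (ShortComplex C)) (M : C) : Prop :=
  (∀ X : C, ∃ (N : C) (g : N ⟶ X), InAdd M N ∧ IsAdmissibleEpi 𝒮 g) ∧
    (∀ X : C, ∃ (N : C) (f : X ⟶ N), InAdd M N ∧ IsAdmissibleMono 𝒮 f)

end Exact

end

/-!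
The theorem rests on the fact that, for a two-sided Noetherian ring `Λ`, the two-sided
`(2,2)`-condition holds if and only if `refl Λ` is quasi-abelian: it has kernels and cokernels,
strict epimorphisms are stable under pullback and strict monomorphisms under pushout
(`isQuasiAbelian_refl_iff`). Being quasi-abelian is invariant under equivalence, so the condition
passes from `Λ` to `Γ`.

Left and right modules are treated together through a bimodule `E` that is regular on both sides
(`RegularBimodule`), with `X^* = Hom(X, E)`. The `(2,2)`-condition says that all submodules of
modules `Ext²(X, E)` have grade at least two (`ExtCondition`). The link with reflexive modules is
dimension shifting: for a map `f : X → Q` with `Q` projective, the cokernel of the restriction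
`X^* → (ker f)^*` embeds in an `Ext²`, and is all of it if `X` is projective
(`exists_dimension_shift`).

Assume the condition. Cokernels which embed in an `Ext²` have no nonzero maps to `E`, so kernels of
maps of reflexive modules are reflexive (`ExtCondition.ker_reflexive`). A map to a reflexive module
is a strict epimorphism in the category of reflexive modules exactly when its module-theoretic
cokernel has grade at least two (`ExtCondition.gradeGeTwo_of_isDualStrictEpi`,
`GradeGeTwo.isDualStrictEpi`). Modules of grade at least two are closed under submodules, as they
embed in an `Ext²` (`GradeGeTwo.of_injective`); since the cokernel of a pullback of `f` embeds in the
cokernel of `f`, strict epimorphisms are stable under pullback (`IsDualStrictEpi.pullback`). The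
duality `X ↦ X^*` (`dualFunctor`) gives the statements about cokernels and strict monomorphisms.
Conversely, in a quasi-abelian category of reflexive modules each submodule of `Ext²(X, E)` is the
cokernel of a pullback of a strict epimorphism, and the stability yields that it has grade at least
two (`extCondition_of_pullback`).

In a quasi-abelian category all kernel-cokernel pairs form an exact structure, the maximum one
(`IsQuasiAbelian.isMaximumExactStructure`). In `refl Γ` the module `Γ` is a generator-cogenerator for
it with endomorphism ring `Γ`, and an equivalence carries `Γ` to the module `M` that is wanted.

Conversely, let `M` be a generator-cogenerator for some exact structure on `refl Λ`, with endomorphism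
ring `Γ`. Then `Hom(M, -)` is an equivalence to `refl Γ` (`homFunctor_isEquivalence`): maps
`Hom(M, X) → Hom(M, Y)` come from maps `X → Y` since `X` is a cokernel of a map to a summand of a
power of `M`; `Hom(M, X)` is reflexive because its dual is `Hom(X, M)` by the same argument, and dually;
and a reflexive `Γ`-module, being the kernel of a matrix over `Γ`, is `Hom(M, K)` for the kernel `K`
of the corresponding map between powers of `M`.
-/

/-! ### Linear connecting maps between Ext modules -/

section Ext

variable {A B E : Type u} [Ring A] [Ring B] [AddCommGroup E] [Module A E] [Module B E]
  [SMulCommClass A B E]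

/-- The `B`-linear connecting map `Ext^l(X₁, E) → Ext^{l+1}(X₃, E)` of a short exact sequence
`0 → X₁ → X₂ → X₃ → 0` of `A`-modules. -/
noncomputable def connectingMap {T : ShortComplex (ModuleCat.{u} A)} (hT : T.ShortExact) (l : ℕ) :
    extObj A B E T.X₁ l →ₗ[B] extObj A B E T.X₃ (l + 1) where
  toFun x := hT.extClass.comp (show Ext.{u} T.X₁ (ModuleCat.of A E) l from x) (add_comm 1 l)
  map_add' x y := Ext.comp_add _ _ _ _
  map_smul' b x := by
    exact (Ext.comp_assoc_of_third_deg_zero hT.extClass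
      (show Ext.{u} T.X₁ (ModuleCat.of A E) l from x) (Ext.mk₀ (smulHom A B E b))
      (add_comm 1 l)).symm

/-- `Hom_A(X, E) ≅ Ext^0(X, E)` as `B`-modules. -/
noncomputable def homEquivExtZero (X : Type u) [AddCommGroup X] [Module A X] :
    (X →ₗ[A] E) ≃ₗ[B] extObj A B E (ModuleCat.of A X) 0 :=
  LinearEquiv.ofBijective
    { toFun := fun φ => show extObj A B E (ModuleCat.of A X) 0 from
        (Ext.mk₀ (ModuleCat.ofHom φ) : Ext.{u} (ModuleCat.of A X) (ModuleCat.of A E) 0)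
      map_add' := fun φ ψ => Ext.mk₀_add (ModuleCat.ofHom φ) (ModuleCat.ofHom ψ)
      map_smul' := fun b φ => by
        exact (Ext.mk₀_comp_mk₀ (ModuleCat.ofHom φ) (smulHom A B E b)).symm }
    ⟨fun φ ψ h => by
      have := (Ext.mk₀_bijective _ _).1 h
      exact ModuleCat.hom_ext_iff.1 this, fun x => by
      obtain ⟨φ, rfl⟩ := (Ext.mk₀_bijective _ _).2 x
      exact ⟨φ.hom, rfl⟩⟩

/-- The short complex `ker p → P → T`. -/
abbrev kerComplex {P T : Type u} [AddCommGroup P] [Module A P] [AddCommGroup T] [Module A T]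
    (p : P →ₗ[A] T) : ShortComplex (ModuleCat.{u} A) :=
  ShortComplex.mk (ModuleCat.ofHom (LinearMap.ker p).subtype) (ModuleCat.ofHom p) (by
    ext x; exact x.2)

theorem kerComplex_shortExact {P T : Type u} [AddCommGroup P] [Module A P] [AddCommGroup T]
    [Module A T] (p : P →ₗ[A] T) (hp : Function.Surjective p) : (kerComplex p).ShortExact where
  exact := by
    rw [ShortComplex.moduleCat_exact_iff]
    intro x hx
    exact ⟨⟨x, hx⟩, rfl⟩
  mono_f := (ModuleCat.mono_iff_injective _).2 (Submodule.injective_subtype _)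
  epi_g := (ModuleCat.epi_iff_surjective _).2 hp

theorem Ext.subsingleton_of_module_projective (P : ModuleCat.{u} A) [Module.Projective A P]
    (Y : ModuleCat.{u} A) (n : ℕ) : Subsingleton (Ext.{u} P Y (n + 1)) := by
  have : Projective P := (IsProjective.iff_projective (R := A) P).1 inferInstance
  exact Ext.subsingleton_of_projective _ _ _

/-- The image of a map `φ` under the connecting map to `Ext¹` is the obstruction to extending `φ`. -/
theorem extClass_comp_mk₀_eq_zero_iff {P T : Type u} [AddCommGroup P] [Module A P]
    [AddCommGroup T] [Module A T] (p : P →ₗ[A] T) (hp : Function.Surjective p)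
    (φ : LinearMap.ker p →ₗ[A] E) :
    (kerComplex_shortExact p hp).extClass.comp (Ext.mk₀ (ModuleCat.ofHom φ)) (add_zero 1) = 0 ↔
      ∃ ψ : P →ₗ[A] E, ψ ∘ₗ (LinearMap.ker p).subtype = φ := by
  constructor
  · intro h
    obtain ⟨x, hx⟩ := Ext.contravariant_sequence_exact₁ (kerComplex_shortExact p hp)
      (ModuleCat.of A E) (Ext.mk₀ (ModuleCat.ofHom φ)) (add_zero 1) h
    obtain ⟨ψ, rfl⟩ := (Ext.mk₀_bijective _ _).2 x
    rw [Ext.mk₀_comp_mk₀] at hx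
    exact ⟨ψ.hom, ModuleCat.hom_ext_iff.1 ((Ext.mk₀_bijective _ _).1 hx)⟩
  · rintro ⟨ψ, rfl⟩
    change (kerComplex_shortExact p hp).extClass.comp
      (Ext.mk₀ ((kerComplex p).f ≫ ModuleCat.ofHom ψ)) (add_zero 1) = _
    rw [← Ext.mk₀_comp_mk₀, ShortComplex.ShortExact.extClass_comp_assoc]

theorem connectingMap_injective {T : ShortComplex (ModuleCat.{u} A)} (hT : T.ShortExact) (l : ℕ)
    (h : Subsingleton (Ext.{u} T.X₂ (ModuleCat.of A E) l)) :
    Function.Injective (connectingMap (B := B) (E := E) hT l) := by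
  rw [injective_iff_map_eq_zero]
  intro x hx
  obtain ⟨y, hy⟩ := Ext.contravariant_sequence_exact₁ hT (ModuleCat.of A E) x (add_comm 1 l) hx
  rw [Subsingleton.elim y 0, Ext.comp_zero] at hy
  exact hy.symm

theorem connectingMap_surjective {T : ShortComplex (ModuleCat.{u} A)} (hT : T.ShortExact) (l : ℕ)
    (h : Subsingleton (Ext.{u} T.X₂ (ModuleCat.of A E) (l + 1))) :
    Function.Surjective (connectingMap (B := B) (E := E) hT l) := fun x =>
  Ext.contravariant_sequence_exact₃ hT (ModuleCat.of A E) x (Subsingleton.elim _ _) (add_comm 1 l)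

/-- Dimension shifting: for `X → Q → D → 0` exact with `Q` projective and first map `f`, the
cokernel of the restriction `Hom(X, E) → Hom(ker f, E)` embeds `B`-linearly in `Ext²(D, E)`, and is
all of it if `X` is projective too. -/
theorem exists_dimension_shift (B : Type u) [Ring B] (E : Type u) [AddCommGroup E] [Module A E]
    [Module B E] [SMulCommClass A B E]
    {X Q D : Type u} [AddCommGroup X] [Module A X] [AddCommGroup Q] [Module A Q]
    [AddCommGroup D] [Module A D] [Module.Projective A Q] (f : X →ₗ[A] Q) (π : Q →ₗ[A] D)
    (hπ : Function.Surjective π) (hf : LinearMap.range f = LinearMap.ker π) :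
    ∃ δ : (LinearMap.ker f →ₗ[A] E) →ₗ[B]
        extObj A B E (ModuleCat.of A D) 2,
      (∀ φ, δ φ = 0 ↔ ∃ ψ : X →ₗ[A] E, ψ ∘ₗ (LinearMap.ker f).subtype = φ) ∧
      (Module.Projective A X → Function.Surjective δ) := by
  -- splice `0 → ker f → X → range f → 0` and `0 → range f → Q → D → 0`
  have hs := kerComplex_shortExact f.rangeRestrict f.surjective_rangeRestrict
  have hT : (ShortComplex.mk (ModuleCat.ofHom (LinearMap.range f).subtype)
      (ModuleCat.ofHom π) (by ext x; exact hf.le x.2)).ShortExact :=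
    { exact := by
        rw [ShortComplex.moduleCat_exact_iff]
        intro x hx
        exact ⟨⟨x, hf.ge hx⟩, rfl⟩
      mono_f := (ModuleCat.mono_iff_injective _).2 (Submodule.injective_subtype _)
      epi_g := (ModuleCat.epi_iff_surjective _).2 hπ }
  have hk : LinearMap.ker f.rangeRestrict = LinearMap.ker f := LinearMap.ker_rangeRestrict f
  let e : LinearMap.ker f.rangeRestrict ≃ₗ[A] LinearMap.ker f := LinearEquiv.ofEq _ _ hk
  let δ₀ : (LinearMap.ker f →ₗ[A] E) →ₗ[B] (LinearMap.ker f.rangeRestrict →ₗ[A] E) :=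
    { toFun := fun φ => φ ∘ₗ e.toLinearMap
      map_add' := fun _ _ => rfl
      map_smul' := fun _ _ => rfl }
  let δ₁ := connectingMap (B := B) (E := E) hs 0
  let δ₂ := connectingMap (B := B) (E := E) hT 1
  have h₂ : Function.Injective δ₂ := connectingMap_injective hT 1
    (Ext.subsingleton_of_module_projective _ _ _)
  refine ⟨δ₂ ∘ₗ δ₁ ∘ₗ (homEquivExtZero _).toLinearMap ∘ₗ δ₀, fun φ => ?_, fun hX => ?_⟩
  · rw [LinearMap.comp_apply, map_eq_zero_iff _ h₂]
    refine (extClass_comp_mk₀_eq_zero_iff f.rangeRestrict f.surjective_rangeRestrict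
      (δ₀ φ)).trans ⟨?_, ?_⟩
    · rintro ⟨ψ, hψ⟩
      refine ⟨ψ, LinearMap.ext fun x => ?_⟩
      exact LinearMap.congr_fun hψ (e.symm x)
    · rintro ⟨ψ, rfl⟩
      exact ⟨ψ, rfl⟩
  · have h₂' : Function.Surjective δ₂ := connectingMap_surjective hT 1
      (Ext.subsingleton_of_module_projective _ _ _)
    have h₁' : Function.Surjective δ₁ := connectingMap_surjective hs 0
      (Ext.subsingleton_of_module_projective _ _ _)
    have h₀ : Function.Surjective δ₀ := fun φ => ⟨φ ∘ₗ e.symm.toLinearMap, rfl⟩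
    exact h₂'.comp (h₁'.comp ((homEquivExtZero (B := B) _).surjective.comp h₀))

end Ext

/-! ### Modules of grade at least two -/

/-- `Hom(T, E) = 0` and `Ext¹(T, E) = 0`, the latter phrased through extension of linear maps
from the kernel of any epimorphism onto `T`; see `gradeGeTwo_iff_subsingleton_ext`. -/
structure GradeGeTwo (B E T : Type u) [Ring B] [AddCommGroup E] [Module B E] [AddCommGroup T]
    [Module B T] : Prop where
  hom_eq_zero : ∀ f : T →ₗ[B] E, f = 0
  exists_extend : ∀ {P : Type u} [AddCommGroup P] [Module B P] (p : P →ₗ[B] T),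
    Function.Surjective p → ∀ φ : LinearMap.ker p →ₗ[B] E,
      ∃ ψ : P →ₗ[B] E, ψ ∘ₗ (LinearMap.ker p).subtype = φ

section Grade

variable {B E T : Type u} [Ring B] [AddCommGroup E] [Module B E] [AddCommGroup T] [Module B T]

theorem GradeGeTwo.of_subsingleton_ext
    (h₀ : Subsingleton (Ext.{u} (ModuleCat.of B T) (ModuleCat.of B E) 0))
    (h₁ : Subsingleton (Ext.{u} (ModuleCat.of B T) (ModuleCat.of B E) 1)) :
    GradeGeTwo B E T where
  hom_eq_zero f := by
    have := (Ext.mk₀_bijective (ModuleCat.of B T) (ModuleCat.of B E)).1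
      (Subsingleton.elim (Ext.mk₀ (ModuleCat.ofHom f)) (Ext.mk₀ (ModuleCat.ofHom 0)))
    exact ModuleCat.hom_ext_iff.1 this
  exists_extend p hp φ :=
    (extClass_comp_mk₀_eq_zero_iff p hp φ).1
      (h₁.elim _ _)

/-- Vanishing of `Ext¹` may be tested on a single epimorphism from a projective module. -/
theorem subsingleton_ext_of_projective (h₀ : ∀ f : T →ₗ[B] E, f = 0)
    {P : Type u} [AddCommGroup P] [Module B P] [Module.Projective B P] (p : P →ₗ[B] T)
    (hp : Function.Surjective p) (h₁ : ∀ φ : LinearMap.ker p →ₗ[B] E,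
      ∃ ψ : P →ₗ[B] E, ψ ∘ₗ (LinearMap.ker p).subtype = φ) :
    Subsingleton (Ext.{u} (ModuleCat.of B T) (ModuleCat.of B E) 0) ∧
      Subsingleton (Ext.{u} (ModuleCat.of B T) (ModuleCat.of B E) 1) := by
  constructor
  · refine ⟨fun x y => ?_⟩
    obtain ⟨f, rfl⟩ := (Ext.mk₀_bijective _ _).2 x
    obtain ⟨g, rfl⟩ := (Ext.mk₀_bijective _ _).2 y
    rw [show f = g from ModuleCat.hom_ext ((h₀ _).trans (h₀ _).symm)]
  · refine ⟨fun x y => ?_⟩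
    have key : ∀ z : Ext.{u} (ModuleCat.of B T) (ModuleCat.of B E) 1, z = 0 := fun z => by
      have := Ext.subsingleton_of_module_projective (ModuleCat.of B P) (ModuleCat.of B E) 0
      obtain ⟨w, rfl⟩ := Ext.contravariant_sequence_exact₃ (kerComplex_shortExact p hp)
        (ModuleCat.of B E) z (Subsingleton.elim _ _) (add_zero 1)
      obtain ⟨φ, rfl⟩ := (Ext.mk₀_bijective _ _).2 w
      exact (extClass_comp_mk₀_eq_zero_iff p hp φ.hom).2 (h₁ φ.hom)
    rw [key x, key y]

theorem GradeGeTwo.of_projective (h₀ : ∀ f : T →ₗ[B] E, f = 0)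
    {P : Type u} [AddCommGroup P] [Module B P] [Module.Projective B P] (p : P →ₗ[B] T)
    (hp : Function.Surjective p) (h₁ : ∀ φ : LinearMap.ker p →ₗ[B] E,
      ∃ ψ : P →ₗ[B] E, ψ ∘ₗ (LinearMap.ker p).subtype = φ) : GradeGeTwo B E T :=
  have h := subsingleton_ext_of_projective h₀ p hp h₁
  .of_subsingleton_ext h.1 h.2

theorem GradeGeTwo.of_linearEquiv (h : GradeGeTwo B E T) {T' : Type u} [AddCommGroup T']
    [Module B T'] (e : T ≃ₗ[B] T') : GradeGeTwo B E T' where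
  hom_eq_zero f := by
    ext x
    simpa using LinearMap.congr_fun (h.hom_eq_zero (f ∘ₗ e.toLinearMap)) (e.symm x)
  exists_extend p hp φ := by
    have hk : LinearMap.ker (e.symm.toLinearMap ∘ₗ p) = LinearMap.ker p := by
      ext; simp
    obtain ⟨ψ, hψ⟩ := h.exists_extend (e.symm.toLinearMap ∘ₗ p) (e.symm.surjective.comp hp)
      (φ ∘ₗ (LinearEquiv.ofEq _ _ hk).toLinearMap)
    exact ⟨ψ, LinearMap.ext fun x => LinearMap.congr_fun hψ ((LinearEquiv.ofEq _ _ hk).symm x)⟩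

end Grade

/-- If the image of `δ` has grade at least two, then restricting linear maps to `E` to the kernel of
`δ` is injective; by `GradeGeTwo.exists_extend_of_range` it is also surjective. -/
theorem GradeGeTwo.eq_zero_of_range {B E V W : Type u} [Ring B] [AddCommGroup E] [Module B E]
    [AddCommGroup V] [Module B V] [AddCommGroup W] [Module B W] {δ : V →ₗ[B] W}
    (h : GradeGeTwo B E (LinearMap.range δ)) (ψ : V →ₗ[B] E)
    (hψ : LinearMap.ker δ ≤ LinearMap.ker ψ) : ψ = 0 := by
  have h0 := h.hom_eq_zero (((LinearMap.ker δ).liftQ ψ hψ) ∘ₗ δ.quotKerEquivRange.symm.toLinearMap)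
  ext x
  have := LinearMap.congr_fun h0 (δ.quotKerEquivRange ((LinearMap.ker δ).mkQ x))
  simpa using this

theorem GradeGeTwo.exists_extend_of_range {B E V W : Type u} [Ring B] [AddCommGroup E] [Module B E]
    [AddCommGroup V] [Module B V] [AddCommGroup W] [Module B W] {δ : V →ₗ[B] W}
    (h : GradeGeTwo B E (LinearMap.range δ)) (φ : LinearMap.ker δ →ₗ[B] E) :
    ∃ ψ : V →ₗ[B] E, ψ ∘ₗ (LinearMap.ker δ).subtype = φ := by
  have hk := LinearMap.ker_rangeRestrict δ
  obtain ⟨ψ, hψ⟩ := h.exists_extend δ.rangeRestrict δ.surjective_rangeRestrict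
    (φ ∘ₗ (LinearEquiv.ofEq _ _ hk).toLinearMap)
  exact ⟨ψ, LinearMap.ext fun x => LinearMap.congr_fun hψ ((LinearEquiv.ofEq _ _ hk).symm x)⟩

/-! ### Duality over a regular bimodule -/

/-- An `A`-`B`-bimodule `E` (both actions written on the left) with an element that is a basis of
`E` over `A` and over `B`. The examples are `Λ` over `Λ` and `Λᵐᵒᵖ`, in either order; working with
`E` treats left and right modules at once. -/
class RegularBimodule (A B E : Type u) [Ring A] [Ring B] [AddCommGroup E] [Module A E]
    [Module B E] : Prop extends SMulCommClass A B E where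
  exists_basis : ∃ e : E, Function.Bijective (fun a : A => a • e) ∧
    Function.Bijective (fun b : B => b • e)

instance {A B E : Type u} [Ring A] [Ring B] [AddCommGroup E] [Module A E] [Module B E]
    [RegularBimodule A B E] : SMulCommClass B A E :=
  SMulCommClass.symm A B E

section Duality

variable (A B E : Type u) [Ring A] [Ring B] [AddCommGroup E] [Module A E] [Module B E]

theorem RegularBimodule.symm [h : RegularBimodule A B E] : RegularBimodule B A E where
  toSMulCommClass := inferInstance
  exists_basis := by
    obtain ⟨e, h₁, h₂⟩ := h.exists_basis
    exact ⟨e, h₂, h₁⟩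

theorem RegularBimodule.exists_equiv [h : RegularBimodule A B E] : Nonempty (A ≃ₗ[A] E) := by
  obtain ⟨e, h₁, -⟩ := h.exists_basis
  exact ⟨LinearEquiv.ofBijective (LinearMap.toSpanSingleton A E e) h₁⟩

theorem RegularBimodule.free [RegularBimodule A B E] : Module.Free A E :=
  .of_equiv (RegularBimodule.exists_equiv A B E).some

theorem RegularBimodule.finite [RegularBimodule A B E] : Module.Finite A E :=
  .equiv (RegularBimodule.exists_equiv A B E).some

theorem RegularBimodule.projective [RegularBimodule A B E] (n : ℕ) :
    Module.Projective A (Fin n → E) :=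
  have := RegularBimodule.free A B E
  inferInstance

theorem RegularBimodule.finite_pi [RegularBimodule A B E] (n : ℕ) :
    Module.Finite A (Fin n → E) :=
  have := RegularBimodule.finite A B E
  inferInstance

theorem RegularBimodule.exists_cover [RegularBimodule A B E] (X : Type u) [AddCommGroup X]
    [Module A X] [Module.Finite A X] :
    ∃ (n : ℕ) (p : (Fin n → E) →ₗ[A] X), Function.Surjective p := by
  obtain ⟨n, f, hf⟩ := Module.Finite.exists_fin' A X
  let e := (RegularBimodule.exists_equiv A B E).some
  exact ⟨n, f ∘ₗ (LinearEquiv.piCongrRight fun _ => e.symm).toLinearMap,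
    hf.comp (LinearEquiv.surjective _)⟩

/-- Every `A`-endomorphism of `E` is multiplication by an element of `B`. -/
theorem RegularBimodule.exists_smul [h : RegularBimodule A B E] (f : E →ₗ[A] E) :
    ∃ b : B, ∀ x, f x = b • x := by
  obtain ⟨e, h₁, h₂⟩ := h.exists_basis
  obtain ⟨b, hb⟩ := h₂.2 (f e)
  refine ⟨b, fun x => ?_⟩
  obtain ⟨a, rfl⟩ := h₁.2 x
  simp only [map_smul] at hb ⊢
  rw [← hb, smul_comm]

variable (X Y Z : Type u) [AddCommGroup X] [Module A X] [AddCommGroup Y] [Module A Y]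
  [AddCommGroup Z] [Module A Z]

/-- The evaluation map from `X` to its double dual with respect to `E`. -/
def evalMap [RegularBimodule A B E] : X →ₗ[A] ((X →ₗ[A] E) →ₗ[B] E) where
  toFun x :=
    { toFun := fun f => f x
      map_add' := fun _ _ => rfl
      map_smul' := fun _ _ => rfl }
  map_add' x y := by
    ext f
    exact f.map_add x y
  map_smul' a x := by
    ext f
    exact f.map_smul a x

variable {A X Y}

/-- The dual of an `A`-linear map, as a `B`-linear map. -/
def dualMap [SMulCommClass A B E] (f : X →ₗ[A] Y) : (Y →ₗ[A] E) →ₗ[B] (X →ₗ[A] E) where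
  toFun φ := φ ∘ₗ f
  map_add' _ _ := rfl
  map_smul' _ _ := rfl

variable (A X)

/-- Finitely generated modules which are reflexive with respect to `E`. -/
def IsReflexiveOver [RegularBimodule A B E] : Prop :=
  Module.Finite A X ∧ Function.Bijective (evalMap A B E X)

variable [RegularBimodule A B E]

@[simp]
theorem evalMap_apply (x : X) (f : X →ₗ[A] E) : evalMap A B E X x f = f x := rfl

@[simp]
theorem dualMap_apply (f : X →ₗ[A] Y) (φ : Y →ₗ[A] E) : dualMap B E f φ = φ ∘ₗ f := rfl

variable {A B E X}

theorem IsReflexiveOver.ext (h : IsReflexiveOver A B E X) {x y : X}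
    (hxy : ∀ f : X →ₗ[A] E, f x = f y) : x = y :=
  h.2.1 (LinearMap.ext hxy)

theorem IsReflexiveOver.exists_eval (h : IsReflexiveOver A B E X) (ψ : (X →ₗ[A] E) →ₗ[B] E) :
    ∃ x, ∀ f, ψ f = f x := by
  obtain ⟨x, rfl⟩ := h.2.2 ψ
  exact ⟨x, fun _ => rfl⟩

theorem IsReflexiveOver.mk' (hX : Module.Finite A X)
    (h₁ : ∀ x : X, (∀ f : X →ₗ[A] E, f x = 0) → x = 0)
    (h₂ : ∀ ψ : (X →ₗ[A] E) →ₗ[B] E, ∃ x, ∀ f, ψ f = f x) : IsReflexiveOver A B E X := by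
  refine ⟨hX, ?_, fun ψ => ?_⟩
  · rw [injective_iff_map_eq_zero]
    exact fun x hx => h₁ x fun f => LinearMap.congr_fun hx f
  · obtain ⟨x, hx⟩ := h₂ ψ
    exact ⟨x, LinearMap.ext fun f => (hx f).symm⟩

theorem IsReflexiveOver.of_linearEquiv (h : IsReflexiveOver A B E X) (e : X ≃ₗ[A] Y) :
    IsReflexiveOver A B E Y := by
  have := h.1
  refine .mk' (.equiv e) (fun y hy => ?_) (fun ψ => ?_)
  · rw [← e.symm.map_eq_zero_iff]
    refine h.ext fun f => ?_
    simpa using hy (f ∘ₗ e.symm.toLinearMap)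
  · obtain ⟨x, hx⟩ := h.exists_eval (ψ ∘ₗ dualMap B E e.symm.toLinearMap)
    refine ⟨e x, fun f => ?_⟩
    have := hx (f ∘ₗ e.toLinearMap)
    rw [LinearMap.comp_apply] at this
    refine Eq.trans ?_ this
    congr 1
    ext; simp

variable (A B E) in
theorem isReflexiveOver_self : IsReflexiveOver A B E E := by
  refine .mk' (RegularBimodule.finite A B E) (fun x hx => hx LinearMap.id) fun ψ =>
    ⟨ψ LinearMap.id, fun f => ?_⟩
  obtain ⟨b, hb⟩ := RegularBimodule.exists_smul A B E f
  have : f = b • LinearMap.id := LinearMap.ext hb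
  rw [this, map_smul]
  rfl

theorem IsReflexiveOver.pi {n : ℕ} {X : Fin n → Type u} [∀ i, AddCommGroup (X i)]
    [∀ i, Module A (X i)] (h : ∀ i, IsReflexiveOver A B E (X i)) :
    IsReflexiveOver A B E (∀ i, X i) := by
  have := fun i => (h i).1
  refine .mk' inferInstance (fun x hx => funext fun i => (h i).ext fun f => ?_) fun ψ => ?_
  · simpa using hx (f ∘ₗ LinearMap.proj i)
  · choose x hx using fun i => (h i).exists_eval (ψ ∘ₗ dualMap B E (LinearMap.proj i))
    refine ⟨x, fun f => ?_⟩
    have hf : f = ∑ i, (f ∘ₗ LinearMap.single A X i) ∘ₗ LinearMap.proj i := by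
      ext i y
      simp only [LinearMap.comp_apply, LinearMap.sum_apply]
      rw [Finset.sum_eq_single i] <;> simp +contextual
    conv_lhs => rw [hf]
    rw [map_sum]
    have h2 : ∀ i, ψ ((f ∘ₗ LinearMap.single A X i) ∘ₗ LinearMap.proj i) =
      f (Pi.single i (x i)) := fun i => hx i (f ∘ₗ LinearMap.single A X i)
    simp_rw [h2]
    rw [← map_sum, Finset.univ_sum_single]

theorem IsReflexiveOver.prod (hX : IsReflexiveOver A B E X) (hY : IsReflexiveOver A B E Y) :
    IsReflexiveOver A B E (X × Y) := by
  have := hX.1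
  have := hY.1
  refine .mk' inferInstance (fun x hx => Prod.ext (hX.ext fun f => ?_) (hY.ext fun f => ?_))
    fun ψ => ?_
  · simpa using hx (f ∘ₗ LinearMap.fst A X Y)
  · simpa using hx (f ∘ₗ LinearMap.snd A X Y)
  · obtain ⟨x, hx⟩ := hX.exists_eval (ψ ∘ₗ dualMap B E (LinearMap.fst A X Y))
    obtain ⟨y, hy⟩ := hY.exists_eval (ψ ∘ₗ dualMap B E (LinearMap.snd A X Y))
    refine ⟨(x, y), fun f => ?_⟩
    have hf : f = (f ∘ₗ LinearMap.inl A X Y) ∘ₗ LinearMap.fst A X Y +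
        (f ∘ₗ LinearMap.inr A X Y) ∘ₗ LinearMap.snd A X Y := by
      ext <;> simp [← Prod.zero_eq_mk]
    have h₁ := hx (f ∘ₗ LinearMap.inl A X Y)
    have h₂ := hy (f ∘ₗ LinearMap.inr A X Y)
    simp only [LinearMap.comp_apply, dualMap_apply] at h₁ h₂
    conv_lhs => rw [hf]
    rw [map_add, h₁, h₂, ← map_add]
    simp

variable (A B E) in
theorem isReflexiveOver_pi (n : ℕ) : IsReflexiveOver A B E (Fin n → E) :=
  .pi fun _ => isReflexiveOver_self A B E

variable (X) [RegularBimodule B A E]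

theorem finite_dual [IsNoetherianRing B] [Module.Finite A X] : Module.Finite B (X →ₗ[A] E) := by
  obtain ⟨n, p, hp⟩ := RegularBimodule.exists_cover A B E X
  have := RegularBimodule.finite_pi B A E n
  have : IsNoetherian B (Fin n → E) := isNoetherian_of_isNoetherianRing_of_finite B _
  obtain ⟨e, he₁, -⟩ := RegularBimodule.exists_basis (A := A) (B := B) (E := E)
  -- a map to `E` is determined by its values on generators, so the dual embeds in `E^n`
  let j : (X →ₗ[A] E) →ₗ[B] (Fin n → E) :=
    { toFun := fun f i => f (p (Pi.single i e))
      map_add' := fun _ _ => rfl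
      map_smul' := fun _ _ => rfl }
  have hj : Function.Injective j := by
    rw [injective_iff_map_eq_zero]
    intro f hf
    have h0 : f ∘ₗ p = 0 := by
      ext i y
      obtain ⟨a, rfl⟩ := he₁.2 y
      have h1 : f (p (Pi.single i e)) = 0 := congrFun hf i
      simp [h1]
    ext x
    obtain ⟨y, rfl⟩ := hp x
    exact LinearMap.congr_fun h0 y
  exact Module.Finite.of_injective j hj

variable {X}

theorem IsReflexiveOver.dual [IsNoetherianRing B] (h : IsReflexiveOver A B E X) :
    IsReflexiveOver B A E (X →ₗ[A] E) := by
  have := h.1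
  refine .mk' (finite_dual X) (fun f hf => LinearMap.ext fun x => hf (evalMap A B E X x))
    fun ψ => ⟨ψ ∘ₗ evalMap A B E X, fun f => ?_⟩
  obtain ⟨x, rfl⟩ := h.2.2 f
  rfl

/-- Finitely many generators of the dual of a reflexive module embed it in a free module. -/
theorem IsReflexiveOver.pi_injective (h : IsReflexiveOver A B E X) {n : ℕ}
    {f : Fin n → (X →ₗ[A] E)} (hf : Submodule.span B (Set.range f) = ⊤) :
    Function.Injective (LinearMap.pi f) := by
  rw [injective_iff_map_eq_zero]
  intro x hx
  refine h.ext fun g => ?_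
  have : ⊤ ≤ LinearMap.ker (evalMap A B E X x) := by
    rw [← hf, Submodule.span_le]
    rintro _ ⟨i, rfl⟩
    exact congrFun hx i
  simpa using this (Submodule.mem_top (x := g))

variable (A B E X) in
theorem exists_dual_generators [IsNoetherianRing B] [Module.Finite A X] :
    ∃ (n : ℕ) (f : Fin n → (X →ₗ[A] E)), Submodule.span B (Set.range f) = ⊤ :=
  have := finite_dual (B := B) (E := E) (A := A) X
  Module.Finite.exists_fin

theorem IsReflexiveOver.exists_embedding [IsNoetherianRing B] (h : IsReflexiveOver A B E X) :
    ∃ (n : ℕ) (j : X →ₗ[A] (Fin n → E)), Function.Injective j := by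
  have := h.1
  obtain ⟨n, f, hf⟩ := exists_dual_generators A B E X
  exact ⟨n, _, h.pi_injective hf⟩

end Duality

/-! ### The Ext condition, kernels and strict epimorphisms -/

theorem LinearMap.exists_factor {R P T W : Type*} [Ring R] [AddCommGroup P] [Module R P]
    [AddCommGroup T] [Module R T] [AddCommGroup W] [Module R W] {p : P →ₗ[R] T}
    (hp : Function.Surjective p) (ψ : P →ₗ[R] W) (h : LinearMap.ker p ≤ LinearMap.ker ψ) :
    ∃ g : T →ₗ[R] W, g ∘ₗ p = ψ := by
  refine ⟨(LinearMap.ker p).liftQ ψ h ∘ₗ (p.quotKerEquivOfSurjective hp).symm.toLinearMap, ?_⟩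
  ext x
  have : (p.quotKerEquivOfSurjective hp).symm (p x) = (LinearMap.ker p).mkQ x := by
    rw [LinearEquiv.symm_apply_eq]
    rfl
  simp [this]

/-- The `(2,2)`-condition on `Ext²_A(-, E)`: for `X` finitely generated, all `B`-submodules of
`Ext²_A(X, E)` have grade at least two. -/
def ExtCondition (A B E : Type u) [Ring A] [Ring B] [AddCommGroup E] [Module A E]
    [Module B E] [SMulCommClass A B E] : Prop :=
  ∀ X : ModuleCat.{u} A, Module.Finite A X → ∀ N : Submodule B (extObj A B E X 2),
    GradeGeTwo B E N

/-- `f : Y → Z` is a strict epimorphism as seen by maps to `E`: each `Y → E` which vanishes on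
`ker f` factors uniquely through `f`. For reflexive modules this means that `f` is the cokernel
of its kernel in the category of reflexive modules. -/
def IsDualStrictEpi {A : Type u} [Ring A] (E : Type u) [AddCommGroup E] [Module A E]
    {Y Z : Type u} [AddCommGroup Y] [Module A Y] [AddCommGroup Z] [Module A Z]
    (f : Y →ₗ[A] Z) : Prop :=
  ∀ η : Y →ₗ[A] E, LinearMap.ker f ≤ LinearMap.ker η → ∃! ζ : Z →ₗ[A] E, ζ ∘ₗ f = η

/-- The submodule `Y ×_Z W` of `Y × W`. -/
abbrev pullbackModule {A Y Z W : Type u} [Ring A] [AddCommGroup Y] [Module A Y] [AddCommGroup Z]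
    [Module A Z] [AddCommGroup W] [Module A W] (f : Y →ₗ[A] Z) (c : W →ₗ[A] Z) :
    Submodule A (Y × W) :=
  LinearMap.ker (f ∘ₗ LinearMap.fst A Y W - c ∘ₗ LinearMap.snd A Y W)

section Strict

variable {A B E : Type u} [Ring A] [Ring B] [AddCommGroup E] [Module A E] [Module B E]
  {X Y Z W T : Type u} [AddCommGroup X] [Module A X] [AddCommGroup Y] [Module A Y]
  [AddCommGroup Z] [Module A Z] [AddCommGroup W] [Module A W] [AddCommGroup T] [Module A T]

theorem mem_pullbackModule {f : Y →ₗ[A] Z} {c : W →ₗ[A] Z} {x : Y × W} :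
    x ∈ pullbackModule f c ↔ f x.1 = c x.2 := by
  simp [pullbackModule, sub_eq_zero]

theorem GradeGeTwo.isDualStrictEpi {g : Y →ₗ[A] Z} (h : GradeGeTwo A E (Z ⧸ LinearMap.range g)) :
    IsDualStrictEpi E g := by
  intro η hη
  obtain ⟨φ, hφ⟩ := LinearMap.exists_factor g.surjective_rangeRestrict η
    (by rwa [LinearMap.ker_rangeRestrict])
  have hk := (LinearMap.range g).ker_mkQ
  obtain ⟨ζ, hζ⟩ := h.exists_extend (LinearMap.range g).mkQ (Submodule.mkQ_surjective _)
    (φ ∘ₗ (LinearEquiv.ofEq _ _ hk).toLinearMap)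
  have hζg : ζ ∘ₗ g = η := by
    rw [← hφ]
    ext y
    exact LinearMap.congr_fun hζ ⟨g y, hk.ge ⟨y, rfl⟩⟩
  refine ⟨ζ, hζg, fun ζ' hζ' => ?_⟩
  obtain ⟨d, hd⟩ := LinearMap.exists_factor (Submodule.mkQ_surjective (LinearMap.range g))
    (ζ' - ζ) (by
      rw [Submodule.ker_mkQ]
      rintro _ ⟨y, rfl⟩
      have := LinearMap.congr_fun (hζ'.trans hζg.symm) y
      simpa [sub_eq_zero] using this)
  rw [h.hom_eq_zero d, LinearMap.zero_comp] at hd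
  exact sub_eq_zero.1 hd.symm

variable [RegularBimodule A B E] [RegularBimodule B A E]

/-- Under the Ext condition, kernels of maps between reflexive modules are reflexive: for
`K = ker f` the cokernel of `X^* → K^*` embeds in an `Ext²`, so has no nonzero maps to `E`. -/
theorem ExtCondition.ker_reflexive [IsNoetherianRing A] [IsNoetherianRing B]
    (hc : ExtCondition A B E) (hX : IsReflexiveOver A B E X) (hY : IsReflexiveOver A B E Y)
    (f : X →ₗ[A] Y) : IsReflexiveOver A B E (LinearMap.ker f) := by
  -- replace the target by a free module that contains it, so that it is projective
  obtain ⟨n, j, hj⟩ := hY.exists_embedding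
  suffices h : ∀ g : X →ₗ[A] (Fin n → E), IsReflexiveOver A B E (LinearMap.ker g) by
    have hk : LinearMap.ker (j ∘ₗ f) = LinearMap.ker f := by
      ext x
      simp [map_eq_zero_iff j hj]
    exact hk ▸ h (j ∘ₗ f)
  intro g
  have := hX.1
  have := RegularBimodule.projective A B E n
  have := RegularBimodule.finite_pi A B E n
  have : IsNoetherian A X := isNoetherian_of_isNoetherianRing_of_finite A X
  refine .mk' inferInstance (fun x hx => Subtype.ext (hX.ext fun f => ?_)) fun ψ => ?_
  · simpa using hx (f ∘ₗ (LinearMap.ker g).subtype)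
  obtain ⟨δ, hδ, -⟩ := exists_dimension_shift B E g (LinearMap.range g).mkQ
    (Submodule.mkQ_surjective _) (Submodule.ker_mkQ _).symm
  obtain ⟨x, hx⟩ := hX.exists_eval (ψ ∘ₗ dualMap B E (LinearMap.ker g).subtype)
  -- `ψ` extends to evaluation at some `x` on `X^*`; it remains to see that `x ∈ ker g`
  have hxg : g x = 0 := by
    refine (isReflexiveOver_pi A B E n).ext fun q => ?_
    rw [← LinearMap.comp_apply, ← hx, LinearMap.comp_apply, dualMap_apply, map_zero]
    convert map_zero ψ
    ext k
    simp
  have hzero := (hc (ModuleCat.of A ((Fin n → E) ⧸ LinearMap.range g)) inferInstance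
    (LinearMap.range δ)).eq_zero_of_range (ψ - evalMap A B E _ ⟨x, hxg⟩) (by
      intro φ hφ
      obtain ⟨η, rfl⟩ := (hδ φ).1 hφ
      have := hx η
      rw [LinearMap.comp_apply] at this
      simpa [sub_eq_zero] using this)
  exact ⟨⟨x, hxg⟩, fun φ => by simpa [sub_eq_zero] using LinearMap.congr_fun hzero φ⟩

/-- Under the Ext condition, the cokernel `T` of a strict epimorphism to a reflexive module has
grade at least two. With `Ω` the kernel of `E^n → Z → T`, the cokernel of `(E^n)^* → Ω^*` embeds in
an `Ext²`; as it has grade at least two, every evaluation on `(E^n)^*` extends uniquely to `Ω^*`, and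
these extensions provide an inverse of the restriction. -/
theorem ExtCondition.gradeGeTwo_of_isDualStrictEpi [IsNoetherianRing B]
    (hc : ExtCondition A B E) (hZ : IsReflexiveOver A B E Z) {f : Y →ₗ[A] Z}
    (hf : IsDualStrictEpi E f) : GradeGeTwo A E (Z ⧸ LinearMap.range f) := by
  have h₀ : ∀ g : (Z ⧸ LinearMap.range f) →ₗ[A] E, g = 0 := by
    intro g
    have h1 : (g ∘ₗ (LinearMap.range f).mkQ) ∘ₗ f = 0 := by
      ext y
      have : (LinearMap.range f).mkQ (f y) = 0 := by simp
      simp [this]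
    have h2 := (hf 0 (by simp)).unique h1 (LinearMap.zero_comp f)
    exact Submodule.linearMap_qext _ h2
  have := hZ.1
  obtain ⟨n, p, hp⟩ := RegularBimodule.exists_cover A B E Z
  obtain ⟨m, j, hj⟩ := hZ.exists_embedding
  have := RegularBimodule.projective A B E n
  have := RegularBimodule.projective A B E m
  have := RegularBimodule.finite_pi A B E m
  let q := (LinearMap.range f).mkQ ∘ₗ p
  have hq : Function.Surjective q := (Submodule.mkQ_surjective _).comp hp
  refine .of_projective h₀ q hq fun ω => ?_
  obtain ⟨δ, hδ, -⟩ := exists_dimension_shift B E (j ∘ₗ p) (LinearMap.range (j ∘ₗ p)).mkQ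
    (Submodule.mkQ_surjective _) (Submodule.ker_mkQ _).symm
  have hle : LinearMap.ker (j ∘ₗ p) ≤ LinearMap.ker q := by
    intro x hx
    have : p x = 0 := by simpa [map_eq_zero_iff j hj] using hx
    simp [q, this]
  -- `δ'` has as kernel the maps on `Ω = ker q` that extend to `E^n`
  let δ' := δ ∘ₗ dualMap B E (Submodule.inclusion hle)
  have hδ' : ∀ φ, δ' φ = 0 ↔ ∃ ψ : (Fin n → E) →ₗ[A] E,
      ψ ∘ₗ (LinearMap.ker q).subtype = φ := by
    intro φ
    refine (hδ _).trans ⟨?_, ?_⟩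
    · rintro ⟨ψ, hψ⟩
      -- `φ` and `ψ` agree on `ker p`, so their difference descends to the image of `f`
      let d := φ - ψ ∘ₗ (LinearMap.ker q).subtype
      have hd : ∀ x : LinearMap.ker q, p x = 0 → d x = 0 := by
        intro x hx
        have hx' : (x : Fin n → E) ∈ LinearMap.ker (j ∘ₗ p) := by simp [hx]
        have := LinearMap.congr_fun hψ ⟨x, hx'⟩
        simp only [d, LinearMap.sub_apply, sub_eq_zero]
        exact this.symm
      let pr : LinearMap.ker q →ₗ[A] LinearMap.range f :=
        (p ∘ₗ (LinearMap.ker q).subtype).codRestrict _ fun x => by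
          exact (Submodule.Quotient.mk_eq_zero _).1 x.2
      have hpr : Function.Surjective pr := by
        rintro ⟨z, hz⟩
        obtain ⟨x, rfl⟩ := hp z
        exact ⟨⟨x, by simpa [q] using hz⟩, rfl⟩
      obtain ⟨r, hr⟩ := LinearMap.exists_factor hpr d fun x hx => hd x (congrArg Subtype.val hx)
      obtain ⟨ζ, hζ, -⟩ := hf (r ∘ₗ f.rangeRestrict) fun y hy => by
        have : f.rangeRestrict y = 0 := Subtype.ext hy
        simp [this]
      refine ⟨ψ + ζ ∘ₗ p, LinearMap.ext fun x => ?_⟩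
      obtain ⟨y, hy⟩ := (pr x).2
      have h1 : d x = ζ (p x) := by
        rw [← hr, LinearMap.comp_apply]
        have h2 : pr x = f.rangeRestrict y := Subtype.ext hy.symm
        rw [h2]
        have h3 := LinearMap.congr_fun hζ y
        rw [LinearMap.comp_apply, LinearMap.comp_apply] at h3
        rw [← h3, hy]
        rfl
      simp only [LinearMap.comp_apply, LinearMap.add_apply, Submodule.subtype_apply, ← h1, d,
        LinearMap.sub_apply]
      abel
    · rintro ⟨ψ, rfl⟩
      exact ⟨ψ, rfl⟩
  have hG := hc (ModuleCat.of A ((Fin m → E) ⧸ LinearMap.range (j ∘ₗ p))) inferInstance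
    (LinearMap.range δ')
  let e₀ : ((Fin n → E) →ₗ[A] E) →ₗ[B] LinearMap.ker δ' :=
    (dualMap B E (LinearMap.ker q).subtype).codRestrict _ fun ψ => (hδ' _).2 ⟨ψ, rfl⟩
  have he₀ : Function.Bijective e₀ := by
    constructor
    · rw [injective_iff_map_eq_zero]
      intro ψ hψ
      obtain ⟨g, rfl⟩ := LinearMap.exists_factor hq ψ fun x hx =>
        LinearMap.congr_fun (congrArg Subtype.val hψ) ⟨x, hx⟩
      rw [h₀ g, LinearMap.zero_comp]
    · rintro ⟨φ, hφ⟩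
      obtain ⟨ψ, rfl⟩ := (hδ' φ).1 hφ
      exact ⟨ψ, rfl⟩
  let e := LinearEquiv.ofBijective e₀ he₀
  -- evaluations on `(E^n)^*` extend to `Ω^*`, uniquely by `huniq`
  have key : ∀ x, ∃ Φ : (LinearMap.ker q →ₗ[A] E) →ₗ[B] E,
      ∀ ψ : (Fin n → E) →ₗ[A] E, Φ (ψ ∘ₗ (LinearMap.ker q).subtype) = ψ x := by
    intro x
    obtain ⟨Φ, hΦ⟩ := hG.exists_extend_of_range (evalMap A B E _ x ∘ₗ e.symm.toLinearMap)
    refine ⟨Φ, fun ψ => ?_⟩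
    have := LinearMap.congr_fun hΦ (e ψ)
    rw [LinearMap.comp_apply, LinearMap.comp_apply, LinearEquiv.coe_coe, e.symm_apply_apply] at this
    exact this
  choose Φ hΦ using key
  have huniq : ∀ Ψ : (LinearMap.ker q →ₗ[A] E) →ₗ[B] E,
      (∀ ψ : (Fin n → E) →ₗ[A] E, Ψ (ψ ∘ₗ (LinearMap.ker q).subtype) = 0) → Ψ = 0 := by
    refine fun Ψ hΨ => hG.eq_zero_of_range Ψ fun φ hφ => ?_
    obtain ⟨ψ, rfl⟩ := (hδ' φ).1 hφ
    exact hΨ ψ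
  refine ⟨{ toFun := fun x => Φ x ω, map_add' := fun x y => ?_, map_smul' := fun a x => ?_ },
    LinearMap.ext fun x => ?_⟩
  · have := huniq (Φ (x + y) - (Φ x + Φ y)) fun ψ => by simp [hΦ]
    simpa [sub_eq_zero] using LinearMap.congr_fun this ω
  · have := huniq (Φ (a • x) - a • Φ x) fun ψ => by simp [hΦ]
    simpa [sub_eq_zero] using LinearMap.congr_fun this ω
  · have := huniq (Φ x - evalMap A B E _ x) fun ψ => by simp [hΦ]
    simpa [sub_eq_zero] using LinearMap.congr_fun this ω

/-- Under the Ext condition for `B`-modules, a finitely generated `A`-module `T` of grade at least two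
embeds in some `Ext²_B(D, E)`, so all its submodules have grade at least two. For a presentation
`E^k → E^m → E^n → T → 0`, the dual sequence `0 → (E^n)^* → (E^m)^* → E^k` is exact because `T` has
grade at least two, and `D` is the cokernel of its last map. -/
theorem GradeGeTwo.of_injective [IsNoetherianRing A] (hc : ExtCondition B A E)
    [Module.Finite A T] (h : GradeGeTwo A E T) (i : X →ₗ[A] T) (hi : Function.Injective i) :
    GradeGeTwo A E X := by
  obtain ⟨n, p, hp⟩ := RegularBimodule.exists_cover A B E T
  have := RegularBimodule.finite_pi A B E n
  have : IsNoetherian A (Fin n → E) := isNoetherian_of_isNoetherianRing_of_finite A _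
  obtain ⟨m, g₀, hg₀⟩ := RegularBimodule.exists_cover A B E (LinearMap.ker p)
  have := RegularBimodule.finite_pi A B E m
  have : IsNoetherian A (Fin m → E) := isNoetherian_of_isNoetherianRing_of_finite A _
  obtain ⟨k, z, hz⟩ := Module.Finite.exists_fin (R := A) (M := LinearMap.ker g₀)
  have := RegularBimodule.projective B A E k
  have := RegularBimodule.finite_pi B A E k
  let g : (Fin m → E) →ₗ[A] (Fin n → E) := (LinearMap.ker p).subtype ∘ₗ g₀
  -- `s` is the dual of a map `E^k → E^m` with image `ker g`, with `(E^k)^*` identified with `E^k`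
  let s : ((Fin m → E) →ₗ[A] E) →ₗ[B] (Fin k → E) :=
    LinearMap.pi fun i => evalMap A B E _ (z i : Fin m → E)
  have hs : ∀ η, s η = 0 ↔ LinearMap.ker g₀ ≤ LinearMap.ker η := by
    intro η
    constructor
    · intro hη x hx
      have : ⊤ ≤ LinearMap.ker (η ∘ₗ (LinearMap.ker g₀).subtype) := by
        rw [← hz, Submodule.span_le]
        rintro _ ⟨i, rfl⟩
        exact congrFun hη i
      exact this (Submodule.mem_top (x := (⟨x, hx⟩ : LinearMap.ker g₀)))
    · intro hη
      ext i
      exact hη (z i).2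
  obtain ⟨δ, hδ, -⟩ := exists_dimension_shift A E s (LinearMap.range s).mkQ
    (Submodule.mkQ_surjective _) (Submodule.ker_mkQ _).symm
  let e₀ : ((Fin n → E) →ₗ[A] E) →ₗ[B] LinearMap.ker s :=
    (dualMap B E g).codRestrict _ fun ψ => (hs _).2 fun x hx => by
      have : g₀ x = 0 := hx
      simp [g, this]
  have he₀ : Function.Bijective e₀ := by
    constructor
    · rw [injective_iff_map_eq_zero]
      intro ψ hψ
      obtain ⟨r, rfl⟩ := LinearMap.exists_factor hp ψ fun x hx => by
        obtain ⟨y, hy⟩ := hg₀ ⟨x, hx⟩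
        have := LinearMap.congr_fun (congrArg Subtype.val hψ) y
        have h2 : g y = x := congrArg Subtype.val hy
        rw [← h2]
        exact this
      rw [h.hom_eq_zero r, LinearMap.zero_comp]
    · rintro ⟨η, hη⟩
      obtain ⟨φ, hφ⟩ := LinearMap.exists_factor hg₀ η ((hs η).1 hη)
      obtain ⟨ψ, rfl⟩ := h.exists_extend p hp φ
      exact ⟨ψ, Subtype.ext hφ⟩
  let e := LinearEquiv.ofBijective e₀ he₀
  -- `Θ` sends `x` to the class of evaluation at `x` on `ker s ≅ (E^n)^*`, with kernel `ker p`
  let Θ := δ ∘ₗ dualMap A E e.symm.toLinearMap ∘ₗ evalMap A B E (Fin n → E)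
  have hΘ : ∀ x, Θ x = 0 ↔ p x = 0 := by
    intro x
    refine (hδ _).trans ⟨?_, ?_⟩
    · rintro ⟨ψ, hψ⟩
      obtain ⟨y, hy⟩ := (isReflexiveOver_pi A B E m).exists_eval ψ
      have : x = g y := by
        refine (isReflexiveOver_pi A B E n).ext fun r => ?_
        have h1 := LinearMap.congr_fun hψ (e r)
        simp only [LinearMap.comp_apply, dualMap_apply, LinearEquiv.coe_coe,
          LinearEquiv.symm_apply_apply, evalMap_apply, hy] at h1
        exact h1.symm
      rw [this]
      exact (g₀ y).2
    · intro hx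
      obtain ⟨y, hy⟩ := hg₀ ⟨x, hx⟩
      refine ⟨evalMap A B E _ y, ?_⟩
      ext ψ
      obtain ⟨r, rfl⟩ := e.surjective ψ
      simp only [LinearMap.comp_apply, dualMap_apply, LinearEquiv.coe_coe,
        LinearEquiv.symm_apply_apply, evalMap_apply]
      have h2 : g y = x := congrArg Subtype.val hy
      rw [← h2]
      rfl
  obtain ⟨ι, hι⟩ := LinearMap.exists_factor hp Θ fun x hx => (hΘ x).2 hx
  have hιi : Function.Injective (ι ∘ₗ i) := by
    rw [injective_iff_map_eq_zero]
    intro x hx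
    obtain ⟨y, hy⟩ := hp (i x)
    have h1 : Θ y = 0 := by
      rw [← hι, LinearMap.comp_apply, hy]
      exact hx
    rw [(hΘ y).1 h1] at hy
    exact (map_eq_zero_iff i hi).1 hy.symm
  exact (hc (ModuleCat.of B ((Fin k → E) ⧸ LinearMap.range s)) inferInstance
    (LinearMap.range (ι ∘ₗ i))).of_linearEquiv (LinearEquiv.ofInjective _ hιi).symm

/-- Under the Ext condition on both sides, strict epimorphisms of reflexive modules are stable
under pullback: the cokernel of the pullback embeds in the cokernel of the given map. -/
theorem IsDualStrictEpi.pullback [IsNoetherianRing A] [IsNoetherianRing B]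
    (hc : ExtCondition A B E) (hc' : ExtCondition B A E) (hZ : IsReflexiveOver A B E Z)
    {f : Y →ₗ[A] Z} (hf : IsDualStrictEpi E f) (c : W →ₗ[A] Z) :
    IsDualStrictEpi E (LinearMap.snd A Y W ∘ₗ (pullbackModule f c).subtype) := by
  have := hZ.1
  have hr : LinearMap.range (LinearMap.snd A Y W ∘ₗ (pullbackModule f c).subtype) =
      (LinearMap.range f).comap c := by
    ext w
    constructor
    · rintro ⟨x, rfl⟩
      exact ⟨x.1.1, mem_pullbackModule.1 x.2⟩
    · rintro ⟨y, hy⟩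
      exact ⟨⟨(y, w), mem_pullbackModule.2 hy⟩, rfl⟩
  refine GradeGeTwo.isDualStrictEpi (GradeGeTwo.of_injective hc'
    (hc.gradeGeTwo_of_isDualStrictEpi hZ hf) (Submodule.mapQ _ _ c hr.le) ?_)
  rw [← LinearMap.ker_eq_bot, Submodule.ker_mapQ, ← hr, Submodule.mkQ_map_self]

/-- If kernels of maps of reflexive `A`-modules are reflexive, and strict epimorphisms of reflexive
`B`-modules are stable under pullback, then the Ext condition holds: a submodule of `Ext²_A(X, E)`
is the cokernel of a pullback of the strict epimorphism `P₁^* → Z^*`, where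
`0 → Z → P₁ → P₀ → X → 0` is exact with `P₁` and `P₀` free. -/
theorem extCondition_of_pullback [IsNoetherianRing A] [IsNoetherianRing B]
    (hker : ∀ {X Y : Type u} [AddCommGroup X] [Module A X] [AddCommGroup Y] [Module A Y],
      IsReflexiveOver A B E X → IsReflexiveOver A B E Y → ∀ f : X →ₗ[A] Y,
        IsReflexiveOver A B E (LinearMap.ker f))
    (hpb : ∀ {Y Z W : Type u} [AddCommGroup Y] [Module B Y] [AddCommGroup Z] [Module B Z]
      [AddCommGroup W] [Module B W], IsReflexiveOver B A E Y → IsReflexiveOver B A E Z →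
        IsReflexiveOver B A E W → ∀ f : Y →ₗ[B] Z, IsDualStrictEpi E f → ∀ c : W →ₗ[B] Z,
          IsDualStrictEpi E (LinearMap.snd B Y W ∘ₗ (pullbackModule f c).subtype)) :
    ExtCondition A B E := by
  intro X hX N
  obtain ⟨n₀, π, hπ⟩ := RegularBimodule.exists_cover A B E X
  have := RegularBimodule.finite_pi A B E n₀
  have := RegularBimodule.projective A B E n₀
  have : IsNoetherian A (Fin n₀ → E) := isNoetherian_of_isNoetherianRing_of_finite A _
  obtain ⟨n₁, f₀, hf₀⟩ := RegularBimodule.exists_cover A B E (LinearMap.ker π)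
  have := RegularBimodule.finite_pi A B E n₁
  have := RegularBimodule.projective A B E n₁
  let f : (Fin n₁ → E) →ₗ[A] (Fin n₀ → E) := (LinearMap.ker π).subtype ∘ₗ f₀
  have hf : LinearMap.range f = LinearMap.ker π := by
    rw [LinearMap.range_comp, LinearMap.range_eq_top.2 hf₀, Submodule.map_subtype_top]
  obtain ⟨δ, hδ, hδs⟩ := exists_dimension_shift B E f π hπ hf
  replace hδs := hδs inferInstance
  have hP := isReflexiveOver_pi A B E n₁
  have hZ := hker hP (isReflexiveOver_pi A B E n₀) f
  have := hZ.1
  have := finite_dual (B := B) (E := E) (A := A) (LinearMap.ker f)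
  have : Module.Finite B (extObj A B E X 2) := .of_surjective δ hδs
  have : IsNoetherian B (extObj A B E X 2) := isNoetherian_of_isNoetherianRing_of_finite B _
  have hg : IsDualStrictEpi E (dualMap B E (LinearMap.ker f).subtype) := by
    intro η hη
    obtain ⟨x, hx⟩ := hP.exists_eval η
    have hxf : f x = 0 := by
      refine (isReflexiveOver_pi A B E n₀).ext fun q => ?_
      rw [← LinearMap.comp_apply, ← hx, map_zero]
      refine hη (LinearMap.ext fun k => ?_)
      have := k.2
      simp only [LinearMap.mem_ker] at this
      simp [this]
    refine ⟨evalMap A B E _ ⟨x, hxf⟩, LinearMap.ext fun q => (hx q).symm, fun ζ hζ => ?_⟩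
    obtain ⟨y, hy⟩ := hZ.exists_eval ζ
    have hyx : y = ⟨x, hxf⟩ := by
      refine Subtype.ext (hP.ext fun q => ?_)
      rw [← hx q, ← hζ, LinearMap.comp_apply, hy]
      rfl
    rw [← hyx]
    exact LinearMap.ext hy
  -- lift a cover `E^n → N ⊆ Ext²` to `c : E^n → Z^*`; the image of `P₁^* ×_{Z^*} E^n` in `E^n` is
  -- the kernel of the cover
  obtain ⟨n, p, hp⟩ := RegularBimodule.exists_cover B A E N
  have := RegularBimodule.projective B A E n
  obtain ⟨c, hc⟩ := Module.projective_lifting_property δ (N.subtype ∘ₗ p) hδs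
  have hs := hpb hP.dual hZ.dual (isReflexiveOver_pi B A E n)
    (dualMap B E (LinearMap.ker f).subtype) hg c
  have hmem : ∀ w, p w = 0 → ∃ v : pullbackModule (dualMap B E (LinearMap.ker f).subtype) c,
      v.1.2 = w := by
    intro w hw
    have h1 : δ (c w) = 0 := by
      rw [← LinearMap.comp_apply, hc, LinearMap.comp_apply, hw, map_zero]
    obtain ⟨ψ, hψ⟩ := (hδ _).1 h1
    exact ⟨⟨(ψ, w), mem_pullbackModule.2 hψ⟩, rfl⟩
  have hmem' : ∀ v : pullbackModule (dualMap B E (LinearMap.ker f).subtype) c, p v.1.2 = 0 := by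
    intro v
    refine Subtype.ext ?_
    have h1 : δ (c v.1.2) = 0 := (hδ _).2 ⟨v.1.1, mem_pullbackModule.1 v.2⟩
    rw [← LinearMap.comp_apply, hc] at h1
    exact h1
  refine .of_projective (fun r => ?_) p hp fun φ => ?_
  · have h1 : r ∘ₗ p = 0 := (hs 0 (by simp)).unique (LinearMap.ext fun v => by
      have := hmem' v
      simp [this]) (LinearMap.zero_comp _)
    ext t
    obtain ⟨w, rfl⟩ := hp t
    exact LinearMap.congr_fun h1 w
  · let v₀ : pullbackModule (dualMap B E (LinearMap.ker f).subtype) c →ₗ[B] LinearMap.ker p :=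
      (LinearMap.snd B _ _ ∘ₗ Submodule.subtype _).codRestrict _ hmem'
    obtain ⟨ψ, hψ, -⟩ := hs (φ ∘ₗ v₀) fun v hv => by
      have : v₀ v = 0 := Subtype.ext hv
      simp [this]
    refine ⟨ψ, LinearMap.ext fun w => ?_⟩
    obtain ⟨v, hv⟩ := hmem w w.2
    have h1 : ψ v.1.2 = φ (v₀ v) := LinearMap.congr_fun hψ v
    rw [show v₀ v = w from Subtype.ext hv, hv] at h1
    exact h1

end Strict

/-! ### Strict epimorphisms and the exact structure of a quasi-abelian category -/

section StrictEpi

universe v' w'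

variable {C : Type v} [Category.{w} C] [Preadditive C] {D : Type v'} [Category.{w'} D]
  [Preadditive D]

/-- `f` is a cokernel of the totality of all maps that it annihilates. If `f` has a kernel, this
says that `f` is a cokernel of its kernel. Strict monomorphisms are treated as strict
epimorphisms of the opposite category. -/
def IsStrictEpi {Y Z : C} (f : Y ⟶ Z) : Prop :=
  ∀ ⦃W : C⦄ (h : Y ⟶ W), (∀ ⦃K : C⦄ (k : K ⟶ Y), k ≫ f = 0 → k ≫ h = 0) → ∃! g, f ≫ g = h

variable (C) in
/-- Strict epimorphisms are stable under pullback. -/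
def StrictEpisStable : Prop :=
  ∀ ⦃V Y W Z : C⦄ ⦃a : V ⟶ Y⦄ ⦃b : V ⟶ W⦄ ⦃f : Y ⟶ Z⦄ ⦃c : W ⟶ Z⦄,
    IsPullback a b f c → IsStrictEpi f → IsStrictEpi b

variable (C) in
/-- A quasi-abelian category: kernels and cokernels exist, and strict epimorphisms are stable under
pullback, as are strict monomorphisms under pushout. -/
structure IsQuasiAbelian : Prop where
  hasKernels : HasKernels C
  hasCokernels : HasCokernels C
  stable : StrictEpisStable C
  stable_op : StrictEpisStable Cᵒᵖ

theorem IsStrictEpi.epi {Y Z : C} {f : Y ⟶ Z} (hf : IsStrictEpi f) : Epi f where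
  left_cancellation g h hgh :=
    (hf (f ≫ h) fun K k hk => by rw [← Category.assoc, hk, zero_comp]).unique hgh rfl

theorem IsStrictEpi.iso_comp {X Y Z : C} {f : Y ⟶ Z} (hf : IsStrictEpi f) (e : X ≅ Y) :
    IsStrictEpi (e.hom ≫ f) := by
  intro W h hh
  obtain ⟨g, hg, hu⟩ := hf (e.inv ≫ h) fun K k hk => by
    rw [← Category.assoc]
    exact hh _ (by simpa using hk)
  refine ⟨g, by simp [hg], fun g' hg' => hu g' ?_⟩
  rw [← hg']
  simp

theorem IsStrictEpi.map {Y Z : C} {f : Y ⟶ Z} (hf : IsStrictEpi f) (F : C ⥤ D)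
    [F.IsEquivalence] : IsStrictEpi (F.map f) := by
  intro W h hh
  let e := F.objObjPreimageIso W
  obtain ⟨g, hg, hu⟩ := hf (F.preimage (h ≫ e.inv)) fun K k hk => F.map_injective (by
    rw [F.map_comp, F.map_preimage, ← Category.assoc,
      hh (F.map k) (by rw [← F.map_comp, hk, F.map_zero]), zero_comp, F.map_zero])
  refine ⟨F.map g ≫ e.hom, ?_, fun g' hg' => ?_⟩
  · change F.map f ≫ F.map g ≫ e.hom = h
    rw [← Category.assoc, ← F.map_comp, hg, F.map_preimage]
    simp
  · have := hu (F.preimage (g' ≫ e.inv)) (F.map_injective (by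
      change F.map f ≫ g' = h at hg'
      rw [F.map_comp, F.map_preimage, F.map_preimage, ← hg', Category.assoc]))
    rw [← this, F.map_preimage]
    simp

theorem IsStrictEpi.of_map {Y Z : C} {f : Y ⟶ Z} (F : C ⥤ D) [F.IsEquivalence]
    (hf : IsStrictEpi (F.map f)) : IsStrictEpi f := by
  intro W h hh
  obtain ⟨g, hg, hu⟩ := hf (F.map h) fun K k hk => by
    let e := F.objObjPreimageIso K
    have h0 : F.preimage (e.hom ≫ k) ≫ h = 0 := hh _ (F.map_injective (by
      rw [F.map_comp, F.map_preimage, Category.assoc, hk, comp_zero, F.map_zero]))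
    have h1 := congrArg F.map h0
    rw [F.map_comp, F.map_preimage, Category.assoc, F.map_zero] at h1
    rw [← cancel_epi e.hom, h1, comp_zero]
  refine ⟨F.preimage g, F.map_injective (by rw [F.map_comp, F.map_preimage, hg]), fun g' hg' => ?_⟩
  refine F.map_injective ?_
  rw [F.map_preimage]
  refine hu _ ?_
  change _ = _ at hg'
  rw [← F.map_comp, hg']

theorem StrictEpisStable.of_equivalence (h : StrictEpisStable C) (e : C ≌ D) :
    StrictEpisStable D := fun _ _ _ _ _ _ _ _ hp hf =>
  .of_map e.inverse (h (hp.map e.inverse) (hf.map e.inverse))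

theorem hasKernels_of_equivalence (e : C ≌ D) (h : HasKernels C) : HasKernels D := by
  have : HasEqualizers C := Preadditive.hasEqualizers_of_hasKernels
  have : HasEqualizers D := Adjunction.hasLimitsOfShape_of_equivalence e.inverse
  infer_instance

theorem hasCokernels_of_equivalence (e : C ≌ D) (h : HasCokernels C) : HasCokernels D := by
  have : HasCoequalizers C := Preadditive.hasCoequalizers_of_hasCokernels
  have : HasCoequalizers D := Adjunction.hasColimitsOfShape_of_equivalence e.inverse
  infer_instance

theorem IsQuasiAbelian.of_equivalence (h : IsQuasiAbelian C) (e : C ≌ D) : IsQuasiAbelian D where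
  hasKernels := hasKernels_of_equivalence e h.hasKernels
  hasCokernels := hasCokernels_of_equivalence e h.hasCokernels
  stable := h.stable.of_equivalence e
  stable_op := h.stable_op.of_equivalence e.op

theorem IsQuasiAbelian.op (h : IsQuasiAbelian C) : IsQuasiAbelian Cᵒᵖ := by
  have := h.hasKernels
  have := h.hasCokernels
  have : HasEqualizers C := Preadditive.hasEqualizers_of_hasKernels
  have : HasCoequalizers C := Preadditive.hasCoequalizers_of_hasCokernels
  exact ⟨inferInstance, inferInstance, h.stable_op,
    h.stable.of_equivalence (opOpEquivalence C).symm⟩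

/-- Kernel-cokernel pairs in terms of factorizations instead of universal cones. -/
theorem isKernelCokernelPair_iff (T : ShortComplex C) : IsKernelCokernelPair T ↔
    (Mono T.f ∧ ∀ ⦃W : C⦄ (k : W ⟶ T.X₂), k ≫ T.g = 0 → ∃ l, l ≫ T.f = k) ∧
    (Epi T.g ∧ ∀ ⦃W : C⦄ (h : T.X₂ ⟶ W), T.f ≫ h = 0 → ∃ l, T.g ≫ l = h) := by
  constructor
  · rintro ⟨⟨h₁⟩, ⟨h₂⟩⟩
    exact ⟨⟨Fork.IsLimit.mono h₁, fun W k hk =>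
        ⟨_, (KernelFork.IsLimit.lift' h₁ k hk).2⟩⟩,
      ⟨Cofork.IsColimit.epi h₂, fun W h hh => ⟨_, (CokernelCofork.IsColimit.desc' h₂ h hh).2⟩⟩⟩
  · rintro ⟨⟨_, h₁⟩, ⟨_, h₂⟩⟩
    exact ⟨⟨KernelFork.IsLimit.ofι' _ _ fun k hk => ⟨_, (h₁ k hk).choose_spec⟩⟩,
      ⟨CokernelCofork.IsColimit.ofπ' _ _ fun h hh => ⟨_, (h₂ h hh).choose_spec⟩⟩⟩

theorem isKernelCokernelPair_op {T : ShortComplex C} (h : IsKernelCokernelPair T) :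
    IsKernelCokernelPair T.op := by
  rw [isKernelCokernelPair_iff] at h ⊢
  obtain ⟨⟨h₁, h₂⟩, ⟨h₃, h₄⟩⟩ := h
  refine ⟨⟨inferInstanceAs (Mono T.g.op), fun W k hk => ?_⟩,
    ⟨inferInstanceAs (Epi T.f.op), fun W k hk => ?_⟩⟩
  · obtain ⟨l, hl⟩ := h₄ k.unop (Quiver.Hom.op_inj hk)
    exact ⟨l.op, Quiver.Hom.unop_inj hl⟩
  · obtain ⟨l, hl⟩ := h₂ k.unop (Quiver.Hom.op_inj hk)
    exact ⟨l.op, Quiver.Hom.unop_inj hl⟩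

theorem isKernelCokernelPair_unop {T : ShortComplex Cᵒᵖ} (h : IsKernelCokernelPair T) :
    IsKernelCokernelPair T.unop := by
  rw [isKernelCokernelPair_iff] at h ⊢
  obtain ⟨⟨h₁, h₂⟩, ⟨h₃, h₄⟩⟩ := h
  refine ⟨⟨inferInstanceAs (Mono T.g.unop), fun W k hk => ?_⟩,
    ⟨inferInstanceAs (Epi T.f.unop), fun W k hk => ?_⟩⟩
  · obtain ⟨l, hl⟩ := h₄ k.op (Quiver.Hom.unop_inj hk)
    exact ⟨l.unop, Quiver.Hom.op_inj hl⟩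
  · obtain ⟨l, hl⟩ := h₂ k.op (Quiver.Hom.unop_inj hk)
    exact ⟨l.unop, Quiver.Hom.op_inj hl⟩

theorem IsKernelCokernelPair.isStrictEpi {T : ShortComplex C} (h : IsKernelCokernelPair T) :
    IsStrictEpi T.g := by
  rw [isKernelCokernelPair_iff] at h
  obtain ⟨-, ⟨h₃, h₄⟩⟩ := h
  intro W k hk
  obtain ⟨l, hl⟩ := h₄ k (hk _ T.zero)
  exact ⟨l, hl, fun l' hl' => by rw [← cancel_epi T.g, hl]; exact hl'⟩

theorem IsStrictEpi.isKernelCokernelPair {T : ShortComplex C} (h : IsStrictEpi T.g) [Mono T.f]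
    (hk : ∀ ⦃W : C⦄ (k : W ⟶ T.X₂), k ≫ T.g = 0 → ∃ l, l ≫ T.f = k) :
    IsKernelCokernelPair T := by
  rw [isKernelCokernelPair_iff]
  refine ⟨⟨inferInstance, hk⟩, h.epi, fun W k hk' => ?_⟩
  obtain ⟨g, hg, -⟩ := h k fun K l hl => by
    obtain ⟨m, rfl⟩ := hk l hl
    rw [Category.assoc, hk', comp_zero]
  exact ⟨g, hg⟩

/-- The class of all kernel-cokernel pairs. -/
abbrev kernelCokernelPairs (C : Type v) [Category.{w} C] [Preadditive C] :
    ObjectProperty (ShortComplex C) := IsKernelCokernelPair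

theorem isAdmissibleEpi_kernelCokernelPairs_iff [HasKernels C] {Y Z : C} (g : Y ⟶ Z) :
    IsAdmissibleEpi (kernelCokernelPairs C) g ↔ IsStrictEpi g := by
  constructor
  · rintro ⟨X, f, h, hT⟩
    exact hT.isStrictEpi
  · intro h
    refine ⟨kernel g, kernel.ι g, kernel.condition g,
      IsStrictEpi.isKernelCokernelPair (T := ShortComplex.mk _ _ _) h fun W k hk => ?_⟩
    exact ⟨kernel.lift g k hk, kernel.lift_ι _ _ _⟩

theorem isAdmissibleMono_kernelCokernelPairs_iff [HasCokernels C] {Y Z : C} (f : Y ⟶ Z) :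
    IsAdmissibleMono (kernelCokernelPairs C) f ↔ IsStrictEpi f.op := by
  constructor
  · rintro ⟨X, g, h, hT⟩
    exact (isKernelCokernelPair_op hT).isStrictEpi
  · intro h
    refine ⟨cokernel f, cokernel.π f, cokernel.condition f, ?_⟩
    have : Mono (ShortComplex.mk f (cokernel.π f) (cokernel.condition f)).op.f :=
      inferInstanceAs (Mono (cokernel.π f).op)
    refine isKernelCokernelPair_unop (IsStrictEpi.isKernelCokernelPair
      (T := (ShortComplex.mk f (cokernel.π f) (cokernel.condition f)).op) h fun W k hk => ?_)
    have hk' : f ≫ k.unop = 0 := Quiver.Hom.op_inj hk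
    have h' := cokernel.π_desc f k.unop hk'
    exact ⟨(cokernel.desc f k.unop hk').op, Quiver.Hom.unop_inj h'⟩

/-- Strict epimorphisms compose if they are stable under pullback: elements of the kernel of `g` lift
along a pullback of `f`. -/
theorem IsStrictEpi.comp [HasPullbacks C] (hC : StrictEpisStable C) {X Y Z : C} {f : X ⟶ Y}
    {g : Y ⟶ Z} (hf : IsStrictEpi f) (hg : IsStrictEpi g) : IsStrictEpi (f ≫ g) := by
  intro W h hh
  obtain ⟨v, hv, -⟩ := hf h fun K k hk => hh k (by rw [← Category.assoc, hk, zero_comp])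
  obtain ⟨w, hw, -⟩ := hg v fun K k hk => by
    have := (hC (IsPullback.of_hasPullback f k) hf).epi
    rw [← cancel_epi (pullback.snd f k), comp_zero, ← Category.assoc, ← pullback.condition,
      Category.assoc]
    rw [show f ≫ v = h from hv]
    apply hh
    rw [← Category.assoc, pullback.condition, Category.assoc, hk, comp_zero]
  refine ⟨w, by change (f ≫ g) ≫ w = h; rw [Category.assoc, hw, hv], fun w' hw' => ?_⟩
  have := hf.epi
  have := hg.epi
  dsimp only at hw'
  rw [← cancel_epi g, ← cancel_epi f, hw, hv, ← hw', Category.assoc]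

theorem exists_pullback_kernelCokernelPair [HasPullbacks C] (hC : StrictEpisStable C)
    (T : ShortComplex C) (hT : IsKernelCokernelPair T) {M' : C} (c : M' ⟶ T.X₃) :
    ∃ (N' : C) (b : N' ⟶ T.X₂) (g' : N' ⟶ M') (f' : T.X₁ ⟶ N') (h : f' ≫ g' = 0),
      IsPullback b g' T.g c ∧ f' ≫ b = T.f ∧ IsKernelCokernelPair (ShortComplex.mk f' g' h) := by
  have hp := IsPullback.of_hasPullback T.g c
  have hs := hC hp hT.isStrictEpi
  obtain ⟨⟨_, hk⟩, -⟩ := (isKernelCokernelPair_iff T).1 hT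
  let f' : T.X₁ ⟶ pullback T.g c := pullback.lift T.f 0 (by simp)
  have hf' : f' ≫ pullback.fst T.g c = T.f := pullback.lift_fst _ _ _
  have : Mono f' := mono_of_mono_fac hf'
  refine ⟨pullback T.g c, pullback.fst _ _, pullback.snd _ _, f', pullback.lift_snd _ _ _, hp, hf',
    IsStrictEpi.isKernelCokernelPair (T := ShortComplex.mk _ _ _) hs fun W k hk' => ?_⟩
  dsimp only at k hk'
  obtain ⟨l, hl⟩ := hk (k ≫ pullback.fst _ _) (by
    rw [Category.assoc, pullback.condition, ← Category.assoc, hk', zero_comp])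
  refine ⟨l, pullback.hom_ext ?_ ?_⟩
  · dsimp only
    rw [Category.assoc, hf', hl]
  · dsimp only
    rw [Category.assoc, pullback.lift_snd, hk', comp_zero]

/-- In a quasi-abelian category the kernel-cokernel pairs form an exact structure, which is the
maximum one since conflations are kernel-cokernel pairs by definition. -/
theorem IsQuasiAbelian.isMaximumExactStructure [HasBinaryBiproducts C] (hC : IsQuasiAbelian C) :
    IsMaximumExactStructure (kernelCokernelPairs C) := by
  have := hC.hasKernels
  have := hC.hasCokernels
  have : HasEqualizers C := Preadditive.hasEqualizers_of_hasKernels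
  have : HasCoequalizers C := Preadditive.hasCoequalizers_of_hasCokernels
  have : HasPullbacks C := hasPullbacks_of_hasBinaryProducts_of_hasEqualizers C
  have : HasPushouts C := hasPushouts_of_hasBinaryCoproducts_of_hasCoequalizers C
  refine ⟨?_, fun 𝒯 h𝒯 T hT => h𝒯.kernelCokernelPair T hT⟩
  refine { kernelCokernelPair := fun T hT => hT, of_iso := ?_, id_left := ?_, id_right := ?_,
           comp_mono := ?_, comp_epi := ?_, pushout := ?_, pullback := ?_ }
  · rintro T T' ⟨e⟩ hT
    obtain ⟨⟨h₁, h₂⟩, ⟨h₃, h₄⟩⟩ := (isKernelCokernelPair_iff T).1 hT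
    refine (isKernelCokernelPair_iff T').2 ?_
    have e₁ : T'.f = e.inv.τ₁ ≫ T.f ≫ e.hom.τ₂ := by
      rw [← e.hom.comm₁₂, ← Category.assoc, ← ShortComplex.comp_τ₁]; simp
    have e₂ : T'.g = e.inv.τ₂ ≫ T.g ≫ e.hom.τ₃ := by
      rw [← e.hom.comm₂₃, ← Category.assoc, ← ShortComplex.comp_τ₂]; simp
    refine ⟨⟨by rw [e₁]; infer_instance, fun W k hk => ?_⟩,
      ⟨by rw [e₂]; infer_instance, fun W k hk => ?_⟩⟩
    · obtain ⟨l, hl⟩ := h₂ (k ≫ e.inv.τ₂) (by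
        rw [Category.assoc, e.inv.comm₂₃, ← Category.assoc, hk, zero_comp])
      refine ⟨l ≫ e.hom.τ₁, ?_⟩
      rw [Category.assoc, e.hom.comm₁₂, ← Category.assoc, hl, Category.assoc,
        ← ShortComplex.comp_τ₂]
      simp
    · obtain ⟨l, hl⟩ := h₄ (e.hom.τ₂ ≫ k) (by
        rw [← Category.assoc, ← e.hom.comm₁₂, Category.assoc, hk, comp_zero])
      refine ⟨e.inv.τ₃ ≫ l, ?_⟩
      rw [← Category.assoc, ← e.inv.comm₂₃, Category.assoc, hl, ← Category.assoc,
        ← ShortComplex.comp_τ₂]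
      simp
  · intro L Z hZ
    refine (isKernelCokernelPair_iff _).2
      ⟨⟨inferInstanceAs (Mono (𝟙 L)), fun W k _ => ⟨k, Category.comp_id k⟩⟩,
      ⟨⟨fun g h _ => hZ.eq_of_src _ _⟩, fun W h hh => ⟨0, by
        dsimp only at h hh
        rw [Category.id_comp] at hh
        simp [hh]⟩⟩⟩
  · intro Z L hZ
    refine (isKernelCokernelPair_iff _).2 ⟨⟨⟨fun g h _ => hZ.eq_of_tgt _ _⟩, fun W h hh => ⟨0, by
        dsimp only at h hh
        rw [Category.comp_id] at hh
        simp [hh]⟩⟩, ⟨inferInstanceAs (Epi (𝟙 L)), fun W k _ => ⟨k, Category.id_comp k⟩⟩⟩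
  · intro X Y Z f g hf hg
    rw [isAdmissibleMono_kernelCokernelPairs_iff] at hf hg ⊢
    exact hg.comp hC.stable_op hf
  · intro X Y Z f g hf hg
    rw [isAdmissibleEpi_kernelCokernelPairs_iff] at hf hg ⊢
    exact hf.comp hC.stable hg
  · intro T hT L' a
    obtain ⟨N', b, g', f', h, hp, hf, hk⟩ :=
      exists_pullback_kernelCokernelPair hC.stable_op T.op (isKernelCokernelPair_op hT) a.op
    exact ⟨N'.unop, b.unop, g'.unop, f'.unop, Quiver.Hom.op_inj h, hp.unop.flip,
      Quiver.Hom.op_inj hf, isKernelCokernelPair_unop hk⟩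
  · intro T hT M' c
    exact exists_pullback_kernelCokernelPair hC.stable T hT c

end StrictEpi

/-! ### The category of reflexive modules -/

section ReflOver

variable (A B E : Type u) [Ring A] [Ring B] [AddCommGroup E] [Module A E] [Module B E]
  [RegularBimodule A B E]

/-- Reflexivity with respect to `E`, as a property of objects of the category of `A`-modules. -/
def isReflexiveOver : ObjectProperty (ModuleCat.{u} A) := fun X => IsReflexiveOver A B E X

/-- The category of `A`-modules that are reflexive with respect to the bimodule `E`. -/
abbrev ReflOver := (isReflexiveOver A B E).FullSubcategory

variable {A B E}

/-- A reflexive module as an object of `ReflOver A B E`. -/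
abbrev ReflOver.of {X : Type u} [AddCommGroup X] [Module A X] (h : IsReflexiveOver A B E X) :
    ReflOver A B E := ⟨ModuleCat.of A X, h⟩

/-- A linear map as a morphism of `ReflOver A B E`. -/
abbrev ReflOver.ofHom {X Y : ReflOver A B E} (f : X.obj →ₗ[A] Y.obj) : X ⟶ Y :=
  ObjectProperty.homMk (ModuleCat.ofHom f)

theorem ReflOver.hom_ext' {X Y : ReflOver A B E} {f g : X ⟶ Y}
    (h : ∀ x, f.hom.hom x = g.hom.hom x) : f = g :=
  ObjectProperty.hom_ext _ (ModuleCat.hom_ext (LinearMap.ext h))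

theorem ReflOver.congr {X Y : ReflOver A B E} {f g : X ⟶ Y} (h : f = g) (x : X.obj) :
    f.hom.hom x = g.hom.hom x := by rw [h]

/-- The basis element of `E`: maps from `E` to `X` are the elements of `X`. -/
theorem RegularBimodule.exists_generator (A B E : Type u) [Ring A] [Ring B] [AddCommGroup E]
    [Module A E] [Module B E] [RegularBimodule A B E] : ∃ e : E,
    ∀ {X : Type u} [AddCommGroup X] [Module A X],
      (∀ x : X, ∃ φ : E →ₗ[A] X, φ e = x) ∧ ∀ φ ψ : E →ₗ[A] X, φ e = ψ e → φ = ψ := by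
  obtain ⟨e, h₁, -⟩ := RegularBimodule.exists_basis (A := A) (B := B) (E := E)
  let i : A ≃ₗ[A] E := LinearEquiv.ofBijective (LinearMap.toSpanSingleton A E e) h₁
  have hi : i.symm e = 1 := by
    rw [LinearEquiv.symm_apply_eq]
    exact (one_smul A e).symm
  refine ⟨e, fun x => ⟨LinearMap.toSpanSingleton A _ x ∘ₗ i.symm.toLinearMap, ?_⟩, ?_⟩
  · simp [hi]
  · intro φ ψ h
    ext x
    obtain ⟨a, rfl⟩ := h₁.2 x
    simp [h]

instance : HasZeroObject (ReflOver A B E) := by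
  have h : IsReflexiveOver A B E PUnit := .mk' inferInstance (fun _ _ => rfl) fun ψ =>
    ⟨0, fun f => by rw [Subsingleton.elim f 0, map_zero, map_zero]⟩
  refine ⟨⟨ReflOver.of h, ?_⟩⟩
  rw [IsZero.iff_id_eq_zero]
  exact ReflOver.hom_ext' fun x => rfl

instance : HasBinaryBiproducts (ReflOver A B E) where
  has_binary_biproduct X Y := hasBinaryBiproduct_of_total
    { pt := ReflOver.of (X.property.prod Y.property)
      fst := ReflOver.ofHom (LinearMap.fst A X.obj Y.obj)
      snd := ReflOver.ofHom (LinearMap.snd A X.obj Y.obj)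
      inl := ReflOver.ofHom (LinearMap.inl A X.obj Y.obj)
      inr := ReflOver.ofHom (LinearMap.inr A X.obj Y.obj)
      inl_fst := ReflOver.hom_ext' fun x => rfl
      inl_snd := ReflOver.hom_ext' fun x => rfl
      inr_fst := ReflOver.hom_ext' fun x => rfl
      inr_snd := ReflOver.hom_ext' fun x => rfl } (ReflOver.hom_ext' fun x => by
        change (LinearMap.inl A X.obj Y.obj x.1 + LinearMap.inr A X.obj Y.obj x.2) = x
        simp)

instance : HasFiniteBiproducts (ReflOver A B E) :=
  have := hasFiniteProducts_of_has_binary_and_terminal (C := ReflOver A B E)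
  .of_hasFiniteProducts

/-- A kernel in the category of reflexive modules is the kernel of modules, because `E` is an object
of that category and represents the underlying set. -/
theorem isReflexiveOver_ker_of_hasKernels [HasKernels (ReflOver A B E)] {X Y : Type u}
    [AddCommGroup X] [Module A X] [AddCommGroup Y] [Module A Y] (hX : IsReflexiveOver A B E X)
    (hY : IsReflexiveOver A B E Y) (f : X →ₗ[A] Y) :
    IsReflexiveOver A B E (LinearMap.ker f) := by
  let f' : ReflOver.of hX ⟶ ReflOver.of hY := ReflOver.ofHom f
  let j : (kernel f').obj →ₗ[A] LinearMap.ker f := (kernel.ι f').hom.hom.codRestrict _ fun x =>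
    ReflOver.congr (kernel.condition f') x
  obtain ⟨e, he⟩ := RegularBimodule.exists_generator A B E
  refine IsReflexiveOver.of_linearEquiv (kernel f').property (LinearEquiv.ofBijective j ⟨?_, ?_⟩)
  · rw [injective_iff_map_eq_zero]
    intro x hx
    obtain ⟨φ, rfl⟩ := he.1 x
    let φ' : ReflOver.of (isReflexiveOver_self A B E) ⟶ kernel f' := ReflOver.ofHom φ
    have h0 : φ' = 0 := by
      rw [← cancel_mono (kernel.ι f'), zero_comp]
      have : (kernel.ι f').hom.hom ∘ₗ φ = 0 := he.2 _ _ (congrArg Subtype.val hx)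
      exact ReflOver.hom_ext' fun x => LinearMap.congr_fun this x
    exact ReflOver.congr h0 e
  · rintro ⟨x, hx⟩
    obtain ⟨φ, rfl⟩ := he.1 x
    let φ' : ReflOver.of (isReflexiveOver_self A B E) ⟶ ReflOver.of hX := ReflOver.ofHom φ
    have h0 : φ' ≫ f' = 0 := by
      have : f ∘ₗ φ = 0 := he.2 _ _ hx
      exact ReflOver.hom_ext' fun x => LinearMap.congr_fun this x
    exact ⟨(kernel.lift f' φ' h0).hom.hom e,
      Subtype.ext (ReflOver.congr (kernel.lift_ι f' φ' h0) e)⟩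

theorem hasKernels_reflOver (h : ∀ {X Y : Type u} [AddCommGroup X] [Module A X] [AddCommGroup Y]
    [Module A Y], IsReflexiveOver A B E X → IsReflexiveOver A B E Y → ∀ f : X →ₗ[A] Y,
      IsReflexiveOver A B E (LinearMap.ker f)) : HasKernels (ReflOver A B E) := by
  have : (isReflexiveOver A B E).IsClosedUnderKernels := by
    refine ⟨?_⟩
    rintro _ ⟨f, k, hk, hf⟩
    exact (h hf.1 hf.2 f.hom).of_linearEquiv
      ((ModuleCat.kernelIsLimit f).conePointUniqueUpToIso hk).toLinearEquiv
  infer_instance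

/-- Strict epimorphisms in the category of reflexive modules are detected by maps to `E`, because a
map to a reflexive `W` amounts to a `B`-linear map defined on `W^*`. -/
theorem isStrictEpi_reflOver_iff {Y Z : ReflOver A B E} (f : Y ⟶ Z) :
    IsStrictEpi f ↔ IsDualStrictEpi E f.hom.hom := by
  constructor
  · intro hf η hη
    let η' : Y ⟶ ReflOver.of (isReflexiveOver_self A B E) := ReflOver.ofHom η
    obtain ⟨g, hg, hu⟩ := hf η' fun K k hk => ReflOver.hom_ext' fun x => hη (ReflOver.congr hk x)
    refine ⟨g.hom.hom, LinearMap.ext fun y => ReflOver.congr hg y, fun ζ hζ => ?_⟩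
    let ζ' : Z ⟶ ReflOver.of (isReflexiveOver_self A B E) := ReflOver.ofHom ζ
    have : ζ' = g := hu ζ' (ReflOver.hom_ext' fun y => LinearMap.congr_fun hζ y)
    rw [← this]
    rfl
  · intro hf W h hh
    have hker : LinearMap.ker f.hom.hom ≤ LinearMap.ker h.hom.hom := by
      intro y hy
      obtain ⟨e, he⟩ := RegularBimodule.exists_generator A B E
      obtain ⟨φ, rfl⟩ := he.1 y
      let φ' : ReflOver.of (isReflexiveOver_self A B E) ⟶ Y := ReflOver.ofHom φ
      have h0 : φ' ≫ f = 0 := by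
        have : f.hom.hom ∘ₗ φ = 0 := he.2 _ _ hy
        exact ReflOver.hom_ext' fun x => LinearMap.congr_fun this x
      exact ReflOver.congr (hh φ' h0) e
    -- the maps `t ∘ h` with `t : W → E` factor through `f`, linearly in `t`; dualize to get `Z → W`
    choose ζ hζ hu using fun t : W.obj →ₗ[A] E => hf (t ∘ₗ h.hom.hom) (hker.trans
      (LinearMap.ker_le_ker_comp _ _))
    let ζ' : (W.obj →ₗ[A] E) →ₗ[B] (Z.obj →ₗ[A] E) :=
      { toFun := ζ
        map_add' := fun s t => ((hu _ _) (by
          change (ζ s + ζ t) ∘ₗ f.hom.hom = _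
          rw [LinearMap.add_comp, hζ s, hζ t, LinearMap.add_comp])).symm
        map_smul' := fun b t => ((hu _ _) (by
          change (b • ζ t) ∘ₗ f.hom.hom = _
          rw [LinearMap.smul_comp, hζ t]
          rfl)).symm }
    let eW := LinearEquiv.ofBijective _ W.property.2
    let g := eW.symm.toLinearMap ∘ₗ dualMap A E ζ' ∘ₗ evalMap A B E Z.obj
    have hg : ∀ z t, t (g z) = ζ t z := fun z t =>
      LinearMap.congr_fun (eW.apply_symm_apply ((dualMap A E ζ' ∘ₗ evalMap A B E Z.obj) z)) t
    refine ⟨ReflOver.ofHom g, ReflOver.hom_ext' fun y => W.property.ext fun t => ?_,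
      fun g' hg' => ReflOver.hom_ext' fun z => W.property.ext fun t => ?_⟩
    · exact (hg _ t).trans (LinearMap.congr_fun (hζ t) y)
    · rw [show t ((ReflOver.ofHom (X := Z) (Y := W) g).hom.hom z) = ζ t z from hg z t,
        ← hu t (t ∘ₗ g'.hom.hom) (LinearMap.ext fun y => congrArg t (ReflOver.congr hg' y))]
      rfl

/-- The pullback of modules, if reflexive, is the pullback in the category of reflexive modules. -/
theorem isPullback_pullbackModule {Y Z W : ReflOver A B E} (f : Y ⟶ Z) (c : W ⟶ Z)
    (h : IsReflexiveOver A B E (pullbackModule f.hom.hom c.hom.hom)) :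
    IsPullback (ReflOver.ofHom (LinearMap.fst A Y.obj W.obj ∘ₗ Submodule.subtype _) :
        ReflOver.of h ⟶ Y)
      (ReflOver.ofHom (LinearMap.snd A Y.obj W.obj ∘ₗ Submodule.subtype _) : ReflOver.of h ⟶ W)
      f c := by
  refine ⟨⟨ReflOver.hom_ext' fun x => mem_pullbackModule.1 x.2⟩,
    ⟨PullbackCone.IsLimit.mk _ (fun s => ReflOver.ofHom
      ((s.fst.hom.hom.prod s.snd.hom.hom).codRestrict _ fun x =>
        mem_pullbackModule.2 (ReflOver.congr s.condition x))) (fun s => rfl) (fun s => rfl)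
      fun s m h₁ h₂ => ReflOver.hom_ext' fun x => Subtype.ext (Prod.ext (ReflOver.congr h₁ x)
        (ReflOver.congr h₂ x))⟩⟩

theorem IsReflexiveOver.pullbackModule [HasKernels (ReflOver A B E)] {Y Z W : ReflOver A B E}
    (f : Y ⟶ Z) (c : W ⟶ Z) :
    IsReflexiveOver A B E (pullbackModule f.hom.hom c.hom.hom) :=
  isReflexiveOver_ker_of_hasKernels (Y.property.prod W.property) Z.property _

theorem strictEpisStable_reflOver [RegularBimodule B A E] [IsNoetherianRing A] [IsNoetherianRing B]
    [HasKernels (ReflOver A B E)] (hc : ExtCondition A B E) (hc' : ExtCondition B A E) :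
    StrictEpisStable (ReflOver A B E) := by
  intro V Y W Z a b f c hp hf
  have hp' := isPullback_pullbackModule f c (.pullbackModule f c)
  rw [← hp.isoIsPullback_hom_snd _ _ hp']
  refine IsStrictEpi.iso_comp ?_ _
  rw [isStrictEpi_reflOver_iff] at hf ⊢
  exact hf.pullback hc hc' Z.property c.hom.hom

end ReflOver

section Duality

variable (A B E : Type u) [Ring A] [Ring B] [AddCommGroup E] [Module A E] [Module B E]
  [RegularBimodule A B E] [RegularBimodule B A E] [IsNoetherianRing B]

/-- The duality `X ↦ X^*` from reflexive `A`-modules to reflexive `B`-modules. -/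
def dualFunctor : (ReflOver A B E)ᵒᵖ ⥤ ReflOver B A E where
  obj X := ReflOver.of X.unop.property.dual
  map {X Y} f := ReflOver.ofHom (X := ReflOver.of X.unop.property.dual)
    (Y := ReflOver.of Y.unop.property.dual) (dualMap B E f.unop.hom.hom)

instance : (dualFunctor A B E).Faithful where
  map_injective {X _ _ _} h := Quiver.Hom.unop_inj (ReflOver.hom_ext' fun y =>
    X.unop.property.ext fun t => LinearMap.congr_fun (ReflOver.congr h t) y)

instance : (dualFunctor A B E).Full where
  map_surjective {X Y} γ := by
    let eX := LinearEquiv.ofBijective _ X.unop.property.2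
    let γ' : (X.unop.obj →ₗ[A] E) →ₗ[B] (Y.unop.obj →ₗ[A] E) := γ.hom.hom
    let g : Y.unop.obj →ₗ[A] X.unop.obj :=
      eX.symm.toLinearMap ∘ₗ dualMap A E γ' ∘ₗ evalMap A B E Y.unop.obj
    refine ⟨(ReflOver.ofHom g).op, ReflOver.hom_ext' fun t => LinearMap.ext fun y => ?_⟩
    exact LinearMap.congr_fun (eX.apply_symm_apply ((dualMap A E γ' ∘ₗ evalMap A B E _) y)) t

instance [IsNoetherianRing A] : (dualFunctor A B E).EssSurj where
  mem_essImage Y := ⟨Opposite.op (ReflOver.of Y.property.dual),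
    ⟨ObjectProperty.isoMk _ (LinearEquiv.ofBijective _ Y.property.2).toModuleIso.symm⟩⟩

instance [IsNoetherianRing A] : (dualFunctor A B E).IsEquivalence where

variable [IsNoetherianRing A]

theorem isQuasiAbelian_reflOver (hc : ExtCondition A B E) (hc' : ExtCondition B A E) :
    IsQuasiAbelian (ReflOver A B E) := by
  have h₁ : HasKernels (ReflOver A B E) := hasKernels_reflOver hc.ker_reflexive
  have h₂ : HasKernels (ReflOver B A E) := hasKernels_reflOver hc'.ker_reflexive
  have h₃ : HasKernels (ReflOver A B E)ᵒᵖ :=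
    hasKernels_of_equivalence (dualFunctor A B E).asEquivalence.symm h₂
  refine ⟨h₁, ?_, strictEpisStable_reflOver hc hc',
    (strictEpisStable_reflOver hc' hc).of_equivalence (dualFunctor A B E).asEquivalence.symm⟩
  have : HasEqualizers (ReflOver A B E)ᵒᵖ := Preadditive.hasEqualizers_of_hasKernels
  have : HasCoequalizers (ReflOver A B E) :=
    Adjunction.hasColimitsOfShape_of_equivalence (opOpEquivalence _).inverse
  infer_instance

variable {A B E} in
theorem IsQuasiAbelian.reflOver_symm (h : IsQuasiAbelian (ReflOver A B E)) :
    IsQuasiAbelian (ReflOver B A E) :=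
  h.op.of_equivalence (dualFunctor A B E).asEquivalence

theorem extCondition_of_isQuasiAbelian (h : IsQuasiAbelian (ReflOver A B E)) :
    ExtCondition A B E := by
  have := h.hasKernels
  have h' := h.reflOver_symm
  have := h'.hasKernels
  refine extCondition_of_pullback isReflexiveOver_ker_of_hasKernels ?_
  intro Y Z W _ _ _ _ _ _ hY hZ hW f hf c
  let f' : ReflOver.of hY ⟶ ReflOver.of hZ := ReflOver.ofHom f
  let c' : ReflOver.of hW ⟶ ReflOver.of hZ := ReflOver.ofHom c
  have hp := isPullback_pullbackModule f' c' (.pullbackModule f' c')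
  exact (isStrictEpi_reflOver_iff _).1 (h'.stable hp ((isStrictEpi_reflOver_iff f').2 hf))

end Duality

/-! ### Left and right modules over a ring -/

theorem GradeGeTwo.congr {B E E' T : Type u} [Ring B] [AddCommGroup E] [Module B E]
    [AddCommGroup E'] [Module B E'] [AddCommGroup T] [Module B T] (h : GradeGeTwo B E T)
    (e : E ≃ₗ[B] E') : GradeGeTwo B E' T where
  hom_eq_zero f := by
    ext x
    simpa using LinearMap.congr_fun (h.hom_eq_zero (e.symm.toLinearMap ∘ₗ f)) x
  exists_extend p hp φ := by
    obtain ⟨ψ, hψ⟩ := h.exists_extend p hp (e.symm.toLinearMap ∘ₗ φ)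
    refine ⟨e.toLinearMap ∘ₗ ψ, LinearMap.ext fun x => ?_⟩
    have := LinearMap.congr_fun hψ x
    simp only [LinearMap.comp_apply, LinearEquiv.coe_coe] at this ⊢
    rw [this, e.apply_symm_apply]

theorem gradeGeTwo_iff_subsingleton_ext {B E T : Type u} [Ring B] [AddCommGroup E] [Module B E]
    [AddCommGroup T] [Module B T] : GradeGeTwo B E T ↔
      Subsingleton (Ext.{u} (ModuleCat.of B T) (ModuleCat.of B E) 0) ∧
      Subsingleton (Ext.{u} (ModuleCat.of B T) (ModuleCat.of B E) 1) :=
  ⟨fun h => subsingleton_ext_of_projective h.hom_eq_zero (Finsupp.linearCombination B (id : T → T))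
    (Finsupp.linearCombination_id_surjective B T)
    (h.exists_extend _ (Finsupp.linearCombination_id_surjective B T)),
    fun h => .of_subsingleton_ext h.1 h.2⟩

theorem two_le_sgrade_iff {R : Type u} [Ring R] (X : ModuleCat.{u} R) :
    ((2 : ℕ) : ℕ∞) ≤ sgrade R X ↔ ∀ N : Submodule R X, GradeGeTwo R R N := by
  simp only [gradeGeTwo_iff_subsingleton_ext, sgrade, le_sInf_iff, Set.mem_ofPred_eq]
  constructor
  · intro h N
    constructor
    · by_contra hN
      have := h _ ⟨0, N, rfl, not_subsingleton_iff_nontrivial.1 hN⟩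
      norm_cast at this
    · by_contra hN
      have := h _ ⟨1, N, rfl, not_subsingleton_iff_nontrivial.1 hN⟩
      norm_cast at this
  · rintro h _ ⟨n, N, rfl, hN⟩
    norm_cast
    by_contra! hn
    interval_cases n
    · exact not_subsingleton_iff_nontrivial.2 hN (h N).1
    · exact not_subsingleton_iff_nontrivial.2 hN (h N).2

section Sides

variable (Λ : Type u) [Ring Λ]

instance : RegularBimodule Λ Λᵐᵒᵖ Λ where
  exists_basis := by
    refine ⟨1, ?_, ?_⟩
    · simp only [smul_eq_mul, mul_one]
      exact Function.bijective_id
    · simpa [MulOpposite.smul_eq_mul_unop] using MulOpposite.unop_bijective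

instance : RegularBimodule Λᵐᵒᵖ Λ Λ := RegularBimodule.symm Λ Λᵐᵒᵖ Λ

/-- The right regular module, as `Λ` and as `Λᵐᵒᵖ`. -/
def opEquivRight : Λ ≃ₗ[Λᵐᵒᵖ] Λᵐᵒᵖ where
  __ := MulOpposite.opAddEquiv
  map_smul' _ _ := rfl

theorem twoSidedLNCondition_iff : TwoSidedLNCondition Λ 2 2 ↔
    ExtCondition Λ Λᵐᵒᵖ Λ ∧ ExtCondition Λᵐᵒᵖ Λ Λ := by
  rw [TwoSidedLNCondition, and_comm]
  refine and_congr ?_ ?_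
  · refine forall₂_congr fun X _ => (two_le_sgrade_iff _).trans (forall_congr' fun N => ?_)
    exact ⟨fun h => h.congr (opEquivRight Λ).symm, fun h => h.congr (opEquivRight Λ)⟩
  · exact forall₂_congr fun X _ => two_le_sgrade_iff _

-- `Refl Λ` is `ReflOver Λ Λᵐᵒᵖ Λ` by definition
instance : HasFiniteBiproducts (Refl Λ) :=
  inferInstanceAs (HasFiniteBiproducts (ReflOver Λ Λᵐᵒᵖ Λ))

instance : HasBinaryBiproducts (Refl Λ) :=
  hasBinaryBiproducts_of_finite_biproducts _

variable [IsNoetherianRing Λ] [IsNoetherianRing Λᵐᵒᵖ]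

/-- The two-sided `(2,2)`-condition characterizes the Noetherian rings whose reflexive modules form
a quasi-abelian category. -/
theorem isQuasiAbelian_refl_iff : IsQuasiAbelian (Refl Λ) ↔ TwoSidedLNCondition Λ 2 2 := by
  rw [twoSidedLNCondition_iff]
  refine ⟨fun h => ?_, fun h => isQuasiAbelian_reflOver Λ Λᵐᵒᵖ Λ h.1 h.2⟩
  have h' : IsQuasiAbelian (ReflOver Λ Λᵐᵒᵖ Λ) := h
  exact ⟨extCondition_of_isQuasiAbelian _ _ _ h',
    extCondition_of_isQuasiAbelian _ _ _ h'.reflOver_symm⟩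

end Sides

/-! ### Generators and cogenerators of the category of reflexive modules -/

section InAdd

universe v' w'

variable {C : Type v} [Category.{w} C] [Preadditive C] {D : Type v'} [Category.{w'} D]
  [Preadditive D]

/-- `N` is a direct summand of a finite power of `M`, expressed without the power. -/
def IsSummandOfPower (M N : C) : Prop :=
  ∃ (n : ℕ) (i : Fin n → (M ⟶ N)) (p : Fin n → (N ⟶ M)), ∑ j, p j ≫ i j = 𝟙 N

theorem inAdd_iff [HasFiniteBiproducts C] (M N : C) : InAdd M N ↔ IsSummandOfPower M N := by
  constructor
  · rintro ⟨n, B, ⟨r⟩⟩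
    refine ⟨n, fun j => B.bicone.ι j ≫ r.r, fun j => r.i ≫ B.bicone.π j, ?_⟩
    have h : ∑ j, (r.i ≫ B.bicone.π j) ≫ B.bicone.ι j ≫ r.r =
        r.i ≫ (∑ j, B.bicone.π j ≫ B.bicone.ι j) ≫ r.r := by
      simp only [Preadditive.sum_comp, Preadditive.comp_sum, Category.assoc]
    rw [h, IsBilimit.total B.isBilimit, Category.id_comp, r.retract]
  · rintro ⟨n, i, p, h⟩
    refine ⟨n, getBiproductData _, ⟨⟨biproduct.lift p, biproduct.desc i, ?_⟩⟩⟩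
    rw [← h]
    exact biproduct.lift_desc

theorem IsSummandOfPower.map {M N : C} (h : IsSummandOfPower M N) (F : C ⥤ D) [F.Additive] :
    IsSummandOfPower (F.obj M) (F.obj N) := by
  obtain ⟨n, i, p, h⟩ := h
  refine ⟨n, fun j => F.map (i j), fun j => F.map (p j), ?_⟩
  simp_rw [← F.map_comp]
  rw [← F.map_sum, h, F.map_id]

theorem IsSummandOfPower.op {M N : C} (h : IsSummandOfPower M N) :
    IsSummandOfPower (Opposite.op M) (Opposite.op N) := by
  obtain ⟨n, i, p, h⟩ := h
  refine ⟨n, fun j => (p j).op, fun j => (i j).op, ?_⟩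
  simp_rw [← op_comp]
  rw [← op_sum, h, op_id]

theorem IsStrictEpi.comp_iso {X Y Z : C} {f : X ⟶ Y} (hf : IsStrictEpi f) (e : Y ≅ Z) :
    IsStrictEpi (f ≫ e.hom) := by
  intro W h hh
  obtain ⟨g, hg, hu⟩ := hf h fun K k hk => hh k (by rw [← Category.assoc, hk, zero_comp])
  refine ⟨e.inv ≫ g, by simpa using hg, fun g' hg' => ?_⟩
  rw [← hu (e.hom ≫ g') (by simpa using hg')]
  simp

/-- An equivalence transports an object that generates and cogenerates by strict maps to a
generator-cogenerator for the kernel-cokernel pairs. -/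
theorem isGeneratorCogenerator_inverse_obj [HasFiniteBiproducts C] [HasKernels C] [HasCokernels C]
    (e : C ≌ D) (G : D)
    (h₁ : ∀ X : D, ∃ (N : D) (g : N ⟶ X), IsSummandOfPower G N ∧ IsStrictEpi g)
    (h₂ : ∀ X : D, ∃ (N : D) (f : X ⟶ N), IsSummandOfPower G N ∧ IsStrictEpi f.op) :
    IsGeneratorCogenerator (kernelCokernelPairs C) (e.inverse.obj G) := by
  have : HasFiniteProducts D := ⟨fun n => Adjunction.hasLimitsOfShape_of_equivalence e.inverse⟩
  have : e.inverse.Additive := e.inverse.additive_of_preserves_binary_products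
  constructor
  · intro X
    obtain ⟨N, g, hN, hg⟩ := h₁ (e.functor.obj X)
    refine ⟨e.inverse.obj N, e.inverse.map g ≫ (e.unitIso.app X).inv,
      (inAdd_iff _ _).2 (hN.map e.inverse), ?_⟩
    rw [isAdmissibleEpi_kernelCokernelPairs_iff]
    exact (hg.map e.inverse).comp_iso (e.unitIso.app X).symm
  · intro X
    obtain ⟨N, f, hN, hf⟩ := h₂ (e.functor.obj X)
    refine ⟨e.inverse.obj N, (e.unitIso.app X).hom ≫ e.inverse.map f,
      (inAdd_iff _ _).2 (hN.map e.inverse), ?_⟩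
    rw [isAdmissibleMono_kernelCokernelPairs_iff]
    exact (hf.map e.inverse.op).comp_iso (e.unitIso.app X).op

end InAdd

section Generator

variable {A B E : Type u} [Ring A] [Ring B] [AddCommGroup E] [Module A E] [Module B E]
  [RegularBimodule A B E]

/-- A reflexive module is given by the linear relations among finitely many generators of its
dual. -/
theorem IsReflexiveOver.exists_of_relations {X : Type u} [AddCommGroup X] [Module A X]
    (h : IsReflexiveOver A B E X) {n : ℕ} {f : Fin n → (X →ₗ[A] E)}
    (hf : Submodule.span B (Set.range f) = ⊤) (a : Fin n → E)
    (ha : ∀ b : Fin n → B, ∑ i, b i • f i = 0 → ∑ i, b i • a i = 0) : ∃ x, ∀ i, f i x = a i := by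
  have hs : Function.Surjective (Fintype.linearCombination B f) := by
    rw [← LinearMap.range_eq_top, Fintype.range_linearCombination, hf]
  obtain ⟨ψ, hψ⟩ := LinearMap.exists_factor hs (Fintype.linearCombination B a) fun b hb => ha b hb
  obtain ⟨x, hx⟩ := h.exists_eval ψ
  refine ⟨x, fun i => ?_⟩
  have := LinearMap.congr_fun hψ (Pi.single i 1)
  rw [LinearMap.comp_apply, Fintype.linearCombination_apply_single,
    Fintype.linearCombination_apply_single, one_smul, one_smul, hx] at this
  exact this

variable (A B E) in
/-- `E` as an object of the category of reflexive modules. -/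
abbrev ReflOver.unit : ReflOver A B E := ReflOver.of (isReflexiveOver_self A B E)

theorem ReflOver.sum_apply {X Y : ReflOver A B E} {n : ℕ} (f : Fin n → (X ⟶ Y)) (x : X.obj) :
    (∑ j, f j).hom.hom x = ∑ j, (f j).hom.hom x :=
  map_sum (AddMonoidHom.mk' (fun g : X ⟶ Y => g.hom.hom x) fun _ _ => rfl) _ _

theorem isSummandOfPower_pi (n : ℕ) :
    IsSummandOfPower (ReflOver.unit A B E) (ReflOver.of (isReflexiveOver_pi A B E n)) := by
  refine ⟨n, fun j => ReflOver.ofHom (X := ReflOver.unit A B E)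
      (Y := ReflOver.of (isReflexiveOver_pi A B E n)) (LinearMap.single A (fun _ => E) j),
    fun j => ReflOver.ofHom (X := ReflOver.of (isReflexiveOver_pi A B E n))
      (Y := ReflOver.unit A B E) (LinearMap.proj j), ReflOver.hom_ext' fun x => ?_⟩
  rw [ReflOver.sum_apply]
  exact Finset.univ_sum_single x

theorem exists_isStrictEpi (X : ReflOver A B E) : ∃ (N : ReflOver A B E) (g : N ⟶ X),
    IsSummandOfPower (ReflOver.unit A B E) N ∧ IsStrictEpi g := by
  have := X.property.1
  obtain ⟨n, p, hp⟩ := RegularBimodule.exists_cover A B E X.obj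
  refine ⟨ReflOver.of (isReflexiveOver_pi A B E n), ReflOver.ofHom p, isSummandOfPower_pi n,
    (isStrictEpi_reflOver_iff _).2 fun η hη => ?_⟩
  obtain ⟨ζ, hζ⟩ := LinearMap.exists_factor hp η hη
  refine ⟨ζ, hζ, fun ζ' hζ' => LinearMap.ext fun x => ?_⟩
  obtain ⟨y, rfl⟩ := hp x
  exact LinearMap.congr_fun (hζ'.trans hζ.symm) y

/-- Finitely many generators of `X^*` embed `X` as a strict subobject of a power of `E`. -/
theorem exists_isStrictEpi_op [IsNoetherianRing B] [RegularBimodule B A E] (X : ReflOver A B E) :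
    ∃ (N : ReflOver A B E) (f : X ⟶ N),
      IsSummandOfPower (ReflOver.unit A B E) N ∧ IsStrictEpi f.op := by
  have := X.property.1
  obtain ⟨n, f, hf⟩ := exists_dual_generators A B E X.obj
  have hinj := X.property.pi_injective hf
  refine ⟨ReflOver.of (isReflexiveOver_pi A B E n), ReflOver.ofHom (LinearMap.pi f),
    isSummandOfPower_pi n, fun W h hh => ?_⟩
  let h' : W.unop.obj →ₗ[A] (Fin n → E) := h.unop.hom.hom
  -- the values of `h` satisfy the relations among the `f i`, so they come from `X`
  have key : ∀ w, ∃ x, LinearMap.pi f x = h' w := by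
    intro w
    obtain ⟨x, hx⟩ := X.property.exists_of_relations hf (h' w) fun b hb => by
      let k : (Fin n → E) →ₗ[A] E := ∑ i, b i • LinearMap.proj i
      let k' : ReflOver.of (isReflexiveOver_pi A B E n) ⟶ ReflOver.unit A B E := ReflOver.ofHom k
      have hk : k'.op ≫ (ReflOver.ofHom (X := X)
          (Y := ReflOver.of (isReflexiveOver_pi A B E n)) (LinearMap.pi f)).op = 0 := by
        rw [← op_comp]
        refine Quiver.Hom.unop_inj (ReflOver.hom_ext' fun x => ?_)
        have := LinearMap.congr_fun hb x
        simpa [k', k] using this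
      have := ReflOver.congr (Quiver.Hom.op_inj (hh k'.op hk)) w
      change k (h' w) = 0 at this
      simpa [k] using this
    exact ⟨x, funext hx⟩
  choose g hg using key
  let g' : W.unop.obj →ₗ[A] X.obj :=
    { toFun := g
      map_add' := fun x y => hinj (by rw [map_add, hg, hg, hg, map_add])
      map_smul' := fun a x => hinj (by rw [map_smul, hg, hg, map_smul]; rfl) }
  refine ⟨(ReflOver.ofHom g').op, Quiver.Hom.unop_inj (ReflOver.hom_ext' fun w => hg w),
    fun g'' hg'' => Quiver.Hom.unop_inj (ReflOver.hom_ext' fun w => hinj ?_)⟩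
  exact (ReflOver.congr (Quiver.Hom.op_inj hg'') w).trans (hg w).symm

end Generator

section EndomorphismRing

variable {A B E Γ : Type u} [Ring A] [Ring B] [AddCommGroup E] [Module A E] [Module B E]
  [RegularBimodule A B E] [Ring Γ]

/-- An equivalence of categories of reflexive modules identifies `Γ` with the endomorphism ring of
the module corresponding to `Γ`. -/
theorem nonempty_ringEquiv_end (e : ReflOver A B E ≌ ReflOver Γ Γᵐᵒᵖ Γ) :
    Nonempty (Γ ≃+* (Module.End A (e.inverse.obj (ReflOver.unit Γ Γᵐᵒᵖ Γ)).obj)ᵐᵒᵖ) := by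
  have : e.inverse.Additive := e.inverse.additive_of_preserves_binary_products
  let G := ReflOver.unit Γ Γᵐᵒᵖ Γ
  -- right multiplication, for which a product means first the left factor
  let r : Γ → (G ⟶ G) := fun γ =>
    ReflOver.ofHom (X := G) (Y := G) (LinearMap.toSpanSingleton Γ Γ γ)
  have hr : Function.Bijective r := by
    constructor
    · intro a b h
      have h₁ : (1 : Γ) * a = 1 * b := ReflOver.congr h (1 : Γ)
      rwa [one_mul, one_mul] at h₁
    · intro f
      refine ⟨f.hom.hom (1 : Γ), ReflOver.hom_ext' fun x => ?_⟩
      refine (f.hom.hom.map_smul (x : Γ) (1 : Γ)).symm.trans ?_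
      exact congrArg f.hom.hom (mul_one (x : Γ))
  have hr₁ : r 1 = 𝟙 G := ReflOver.hom_ext' fun x => mul_one (x : Γ)
  have hr_mul : ∀ a b, r (a * b) = r a ≫ r b := fun a b =>
    ReflOver.hom_ext' fun x => (mul_assoc (x : Γ) a b).symm
  have hr_add : ∀ a b, r (a + b) = r a + r b := fun a b =>
    ReflOver.hom_ext' fun x => mul_add (x : Γ) a b
  let F : Γ →+* (Module.End A (e.inverse.obj G).obj)ᵐᵒᵖ := RingHom.mk'
    { toFun := fun γ => MulOpposite.op (e.inverse.map (r γ)).hom.hom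
      map_one' := by
        rw [hr₁, e.inverse.map_id]
        rfl
      map_mul' := fun a b => by
        rw [hr_mul, e.inverse.map_comp]
        rfl } fun a b => by
      change MulOpposite.op (e.inverse.map (r (a + b))).hom.hom = _
      rw [hr_add, e.inverse.map_add]
      rfl
  refine ⟨RingEquiv.ofBijective F ⟨fun a b h => ?_, fun f => ?_⟩⟩
  · exact hr.1 (e.inverse.map_injective (ReflOver.hom_ext' fun x =>
      LinearMap.congr_fun (MulOpposite.op_injective h) x))
  · obtain ⟨γ, hγ⟩ := hr.2 (e.inverse.preimage (ReflOver.ofHom f.unop))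
    refine ⟨γ, ?_⟩
    change MulOpposite.op (e.inverse.map (r γ)).hom.hom = f
    rw [hγ, e.inverse.map_preimage]
    rfl

end EndomorphismRing

/-! ### Reconstruction of a category from a generator-cogenerator -/

section Reconstruction

variable {C : Type v} [Category.{u} C] [Preadditive C]

/-- The part of the generator property of `M` in an exact category that reconstructs maps from
their action on maps out of `M`: each object `X` is the cokernel of a map `K → N`, with `N` a summand
of a power of `M`, and maps `M → X` lift to `N` after composition with an epimorphism. The dual
property is expressed in the opposite category. -/
def IsStableGenerator (M : C) : Prop :=
  ∀ X : C, ∃ (N K : C) (k : K ⟶ N) (g : N ⟶ X), IsSummandOfPower M N ∧ k ≫ g = 0 ∧ Epi g ∧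
    (∀ ⦃Z : C⦄ (h : N ⟶ Z), k ≫ h = 0 → ∃ g', g ≫ g' = h) ∧
    ∀ u : M ⟶ X, ∃ (V : C) (v : V ⟶ N) (q : V ⟶ M), Epi q ∧ v ≫ g = q ≫ u

theorem IsStableGenerator.hom_ext {M : C} (hM : IsStableGenerator M) {X Y : C} {a b : X ⟶ Y}
    (h : ∀ u : M ⟶ X, u ≫ a = u ≫ b) : a = b := by
  obtain ⟨N, -, -, g, ⟨n, i, p, hN⟩, -, hg, -⟩ := hM X
  rw [← cancel_epi g, ← Category.id_comp g, ← hN]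
  simp only [Preadditive.sum_comp, Category.assoc]
  refine Finset.sum_congr rfl fun j _ => ?_
  have := h (i j ≫ g)
  simp only [Category.assoc] at this
  rw [this]

/-- Maps `Hom(M, X) → Hom(M, Y)` which are linear over the endomorphisms of `M` are induced by maps
`X → Y`. -/
theorem IsStableGenerator.exists_map {M : C} (hM : IsStableGenerator M) {X Y : C}
    (φ : (M ⟶ X) →+ (M ⟶ Y)) (hφ : ∀ (r : M ⟶ M) (u : M ⟶ X), φ (r ≫ u) = r ≫ φ u) :
    ∃ f : X ⟶ Y, ∀ u, φ u = u ≫ f := by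
  obtain ⟨N, K, k, g, ⟨n, i, p, hN⟩, hkg, hg, hdesc, hlift⟩ := hM X
  -- the map induced by `φ` on the summand `N` of a power of `M`
  let h : N ⟶ Y := ∑ j, p j ≫ φ (i j ≫ g)
  have hh : ∀ w : M ⟶ N, w ≫ h = φ (w ≫ g) := by
    intro w
    have h1 : w ≫ g = ∑ j, (w ≫ p j) ≫ i j ≫ g := by
      conv_lhs => rw [← Category.id_comp g, ← hN]
      simp only [Preadditive.sum_comp, Preadditive.comp_sum, Category.assoc]
    rw [h1, map_sum]
    simp only [h, Preadditive.comp_sum]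
    refine Finset.sum_congr rfl fun j _ => ?_
    rw [hφ, Category.assoc]
  obtain ⟨f, hf⟩ := hdesc h (hM.hom_ext fun u => by
    rw [← Category.assoc, hh, Category.assoc, hkg, comp_zero, comp_zero, map_zero])
  refine ⟨f, fun u => ?_⟩
  obtain ⟨V, v, q, hq, hv⟩ := hlift u
  rw [← cancel_epi q]
  refine hM.hom_ext fun t => ?_
  rw [← Category.assoc q, ← hv, Category.assoc v, hf, ← Category.assoc t v, hh, ← Category.assoc t q,
    ← hφ, Category.assoc, Category.assoc, hv]

theorem IsStableGenerator.exists_map_op {M : C} (hM : IsStableGenerator (Opposite.op M)) {X Y : C}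
    (φ : (X ⟶ M) →+ (Y ⟶ M)) (hφ : ∀ (r : M ⟶ M) (u : X ⟶ M), φ (u ≫ r) = φ u ≫ r) :
    ∃ f : Y ⟶ X, ∀ u, φ u = f ≫ u := by
  obtain ⟨f, hf⟩ := hM.exists_map (X := Opposite.op X) (Y := Opposite.op Y)
    { toFun := fun u => (φ u.unop).op
      map_zero' := by simp
      map_add' := fun u v => by simp } fun r u => by
        change (φ (u.unop ≫ r.unop)).op = _
        rw [hφ]
        rfl
  exact ⟨f.unop, fun u => Quiver.Hom.op_inj (hf u.op)⟩

theorem IsGeneratorCogenerator.isStableGenerator [HasFiniteBiproducts C]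
    {𝒮 : ObjectProperty (ShortComplex C)} (h𝒮 : IsExactStructure 𝒮) {M : C}
    (hM : IsGeneratorCogenerator 𝒮 M) : IsStableGenerator M := by
  intro X
  obtain ⟨N, g, hN, K, k, hkg, hT⟩ := hM.1 X
  obtain ⟨-, hg, hdesc⟩ := (isKernelCokernelPair_iff _).1 (h𝒮.kernelCokernelPair _ hT)
  refine ⟨N, K, k, g, (inAdd_iff _ _).1 hN, hkg, hg, hdesc, fun u => ?_⟩
  obtain ⟨V, v, q, f', h', hp, -, hT'⟩ := h𝒮.pullback _ hT u
  exact ⟨V, v, q, ((isKernelCokernelPair_iff _).1 (h𝒮.kernelCokernelPair _ hT')).2.1, hp.w⟩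

theorem IsGeneratorCogenerator.isStableGenerator_op [HasFiniteBiproducts C]
    {𝒮 : ObjectProperty (ShortComplex C)} (h𝒮 : IsExactStructure 𝒮) {M : C}
    (hM : IsGeneratorCogenerator 𝒮 M) : IsStableGenerator (Opposite.op M) := by
  intro X
  obtain ⟨N, f, hN, Z, g, hfg, hT⟩ := hM.2 X.unop
  obtain ⟨⟨hf, hlift⟩, -⟩ := (isKernelCokernelPair_iff _).1 (h𝒮.kernelCokernelPair _ hT)
  refine ⟨Opposite.op N, Opposite.op Z, g.op, f.op, ((inAdd_iff _ _).1 hN).op,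
    Quiver.Hom.unop_inj hfg, inferInstanceAs (Epi f.op), fun W h hh => ?_, fun u => ?_⟩
  · obtain ⟨l, hl⟩ := hlift h.unop (Quiver.Hom.op_inj hh)
    exact ⟨l.op, Quiver.Hom.unop_inj hl⟩
  · obtain ⟨V, b, f', g', h', hp, -, hT'⟩ := h𝒮.pushout _ hT u.unop
    have : Mono f' := ((isKernelCokernelPair_iff _).1 (h𝒮.kernelCokernelPair _ hT')).1.1
    exact ⟨Opposite.op V, b.op, f'.op, inferInstance, Quiver.Hom.unop_inj hp.w⟩

variable {Γ : Type u} [Ring Γ] {M : C} (c : Γ ≃+ (M ⟶ M)) (hc : ∀ a b, c (a * b) = c a ≫ c b)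

theorem map_one_of_map_mul (c : Γ ≃+ (M ⟶ M)) (hc : ∀ a b, c (a * b) = c a ≫ c b) :
    c 1 = 𝟙 M := by
  have h := hc 1 (c.symm (𝟙 M))
  rw [one_mul, c.apply_symm_apply, Category.comp_id] at h
  exact h.symm

/-- `Hom(M, X)` as a left `Γ`-module, for a ring isomorphism `c` of `Γ` with the endomorphism ring
of `M` (in which a product means first the left factor, then the right one). -/
def homModule (X : C) : ModuleCat.{u} Γ :=
  letI : Module Γ (M ⟶ X) :=
    { smul := fun γ u => c γ ≫ u
      one_smul := fun u => by
        change c 1 ≫ u = u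
        rw [map_one_of_map_mul c hc, Category.id_comp]
      mul_smul := fun a b u => by
        change c (a * b) ≫ u = c a ≫ c b ≫ u
        rw [hc, Category.assoc]
      smul_zero := fun a => comp_zero
      smul_add := fun a u v => Preadditive.comp_add _ _ _ _ _ _
      add_smul := fun a b u => by
        change c (a + b) ≫ u = c a ≫ u + c b ≫ u
        rw [map_add, Preadditive.add_comp]
      zero_smul := fun u => by
        change c 0 ≫ u = 0
        rw [map_zero, zero_comp] }
  ModuleCat.of Γ (M ⟶ X)

/-- An element of `Hom(M, X)` as an element of the `Γ`-module `homModule c hc X`. -/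
abbrev homModule.of {X : C} (u : M ⟶ X) : homModule c hc X := u

/-- A map `X → Y` as a `Γ`-linear map `Hom(M, X) → Hom(M, Y)`. -/
def homModuleMap {X Y : C} (f : X ⟶ Y) : homModule c hc X →ₗ[Γ] homModule c hc Y where
  toFun u := homModule.of c hc ((show M ⟶ X from u) ≫ f)
  map_add' _ _ := Preadditive.add_comp _ _ _ _ _ _
  map_smul' _ _ := Category.assoc _ _ _

/-- A map `X → M` as an element of the dual of `Hom(M, X)`. -/
def homModuleDual {X : C} (f : X ⟶ M) : homModule c hc X →ₗ[Γ] Γ where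
  toFun u := c.symm ((show M ⟶ X from u) ≫ f)
  map_add' u v := by
    rw [← map_add]
    exact congrArg c.symm (Preadditive.add_comp _ _ _ _ _ _)
  map_smul' γ u := by
    apply c.injective
    rw [RingHom.id_apply, smul_eq_mul, hc, c.apply_symm_apply, c.apply_symm_apply]
    exact Category.assoc _ _ _

theorem exists_eq_comp (hM : IsStableGenerator M) {X Y : C}
    (φ : homModule c hc X →ₗ[Γ] homModule c hc Y) : ∃ f : X ⟶ Y, φ = homModuleMap c hc f := by
  obtain ⟨f, hf⟩ := hM.exists_map (X := X) (Y := Y)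
    { toFun := fun u => φ u
      map_zero' := map_zero φ
      map_add' := map_add φ } fun r u => by
        have := map_smul φ (c.symm r) (homModule.of c hc u)
        change φ (c (c.symm r) ≫ u) = c (c.symm r) ≫ φ u at this
        rw [c.apply_symm_apply] at this
        exact this
  exact ⟨f, LinearMap.ext hf⟩

theorem homModuleDual_surjective (hM : IsStableGenerator M) {X : C}
    (φ : homModule c hc X →ₗ[Γ] Γ) : ∃ f : X ⟶ M, φ = homModuleDual c hc f := by
  obtain ⟨f, hf⟩ := exists_eq_comp c hc hM (X := X) (Y := M)
    { toFun := fun u => homModule.of c hc (c (φ u))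
      map_add' := fun u v => by
        change c (φ (u + v)) = c (φ u) + c (φ v)
        rw [map_add, map_add]
      map_smul' := fun γ u => by
        change c (φ (γ • u)) = c γ ≫ c (φ u)
        rw [map_smul, smul_eq_mul, hc] }
  refine ⟨f, LinearMap.ext fun u => c.injective ?_⟩
  exact (LinearMap.congr_fun hf u).trans (c.apply_symm_apply _).symm

/-- `Hom(M, X)` is reflexive: its dual is `Hom(X, M)` because `M` is a generator, and the dual of
that is `Hom(M, X)` because `M` is a cogenerator. -/
theorem isReflexiveOver_homModule [IsNoetherianRing Γ] (hM : IsStableGenerator M)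
    (hM' : IsStableGenerator (Opposite.op M)) (X : C) :
    IsReflexiveOver Γ Γᵐᵒᵖ Γ (homModule c hc X) := by
  have hext : ∀ {Y : C} {a b : Y ⟶ X}, (∀ u : X ⟶ M, a ≫ u = b ≫ u) → a = b := fun h =>
    Quiver.Hom.op_inj (hM'.hom_ext fun u => Quiver.Hom.unop_inj (h u.unop))
  refine .mk' ?_ (fun u hu => ?_) fun ψ => ?_
  -- as `X` embeds in a power of `M`, `Hom(M, X)` embeds in a power of the Noetherian module `Γ`
  · obtain ⟨N, -, -, g, ⟨n, i, p, hN⟩, -, hg, -⟩ := hM' (Opposite.op X)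
    refine Module.Finite.of_injective
      (LinearMap.pi fun j : Fin n => homModuleDual c hc (i j ≫ g).unop) ?_
    rw [injective_iff_map_eq_zero]
    intro u hu
    let u' : M ⟶ X := u
    change u' = 0
    have hu' : ∀ j, (i j ≫ g) ≫ u'.op = 0 := fun j => by
      have := congrFun hu j
      change c.symm (u' ≫ (i j ≫ g).unop) = 0 at this
      rw [map_eq_zero_iff c.symm c.symm.injective] at this
      exact Quiver.Hom.unop_inj this
    refine Quiver.Hom.op_inj ?_
    rw [op_zero, ← cancel_epi g, comp_zero, ← Category.id_comp g, ← hN, Preadditive.sum_comp,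
      Preadditive.sum_comp]
    refine Finset.sum_eq_zero fun j _ => ?_
    rw [Category.assoc, Category.assoc, ← Category.assoc (i j), hu', comp_zero]
  · refine hext (Y := M) (a := u) (b := 0) fun v => ?_
    rw [zero_comp]
    have := hu (homModuleDual c hc v)
    exact (map_eq_zero_iff c.symm c.symm.injective).1 this
  · obtain ⟨g, hg⟩ := hM'.exists_map_op (X := X) (Y := M)
      { toFun := fun v => c (ψ (homModuleDual c hc v))
        map_zero' := by
          rw [← map_zero c, ← map_zero ψ]
          congr 2
          ext u
          change c.symm ((show M ⟶ X from u) ≫ 0) = 0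
          rw [comp_zero, map_zero]
        map_add' := fun v w => by
          rw [← map_add, ← map_add]
          congr 2
          ext u
          change c.symm ((show M ⟶ X from u) ≫ (v + w)) = c.symm _ + c.symm _
          rw [Preadditive.comp_add, map_add] } fun r v => by
        change c (ψ (homModuleDual c hc (v ≫ r))) = c (ψ (homModuleDual c hc v)) ≫ r
        have h1 : homModuleDual c hc (v ≫ r) =
            MulOpposite.op (c.symm r) • homModuleDual c hc v := by
          ext u
          apply c.injective
          change c (c.symm ((show M ⟶ X from u) ≫ v ≫ r)) = c (c.symm _ * c.symm r)
          rw [hc, c.apply_symm_apply, c.apply_symm_apply, c.apply_symm_apply, Category.assoc]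
        rw [h1, map_smul]
        change c (ψ _ * c.symm r) = _
        rw [hc, c.apply_symm_apply]
    refine ⟨homModule.of c hc g, fun φ => ?_⟩
    obtain ⟨v, rfl⟩ := homModuleDual_surjective c hc hM φ
    apply c.injective
    exact (hg v).trans (c.apply_symm_apply _).symm

/-- The functor `Hom(M, -)` to reflexive `Γ`-modules. -/
def homFunctor [IsNoetherianRing Γ] (hM : IsStableGenerator M)
    (hM' : IsStableGenerator (Opposite.op M)) : C ⥤ ReflOver Γ Γᵐᵒᵖ Γ where
  obj X := ReflOver.of (isReflexiveOver_homModule c hc hM hM' X)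
  map {X Y} f := ReflOver.ofHom (X := ReflOver.of (isReflexiveOver_homModule c hc hM hM' X))
    (Y := ReflOver.of (isReflexiveOver_homModule c hc hM hM' Y)) (homModuleMap c hc f)
  map_id X := ReflOver.hom_ext' fun u => Category.comp_id (X := M) (Y := X) u
  map_comp f g := ReflOver.hom_ext' fun u => (Category.assoc (show M ⟶ _ from u) f g).symm

/-- The functor `Hom(M, -)` is an equivalence. It is essentially surjective because reflexive modules
are kernels of maps between free modules, and `Hom(M, M) ≅ Γ`. -/
theorem homFunctor_isEquivalence [IsNoetherianRing Γ] [IsNoetherianRing Γᵐᵒᵖ] [HasKernels C]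
    [HasFiniteBiproducts C] (hM : IsStableGenerator M) (hM' : IsStableGenerator (Opposite.op M)) :
    (homFunctor c hc hM hM').IsEquivalence := by
  have : (homFunctor c hc hM hM').Faithful :=
    ⟨fun h => hM.hom_ext fun u => ReflOver.congr h (homModule.of c hc u)⟩
  have : (homFunctor c hc hM hM').Full := ⟨fun {X Y} φ => by
    obtain ⟨f, hf⟩ := exists_eq_comp c hc hM (X := X) (Y := Y) φ.hom.hom
    exact ⟨f, ReflOver.hom_ext' fun u => (LinearMap.congr_fun hf u).symm⟩⟩
  have : (homFunctor c hc hM hM').EssSurj := ⟨fun Y => by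
    have hY := Y.property
    have := hY.1
    obtain ⟨n, f, hf⟩ := exists_dual_generators Γ Γᵐᵒᵖ Γ Y.obj
    -- `Y` is the kernel of the matrix of relations among the generators of its dual
    obtain ⟨k, b, hb⟩ := Module.Finite.exists_fin (R := Γᵐᵒᵖ)
      (M := LinearMap.ker (Fintype.linearCombination Γᵐᵒᵖ f))
    let d : (⨁ fun _ : Fin n => M) ⟶ (⨁ fun _ : Fin k => M) :=
      biproduct.matrix fun i j => c ((b j : Fin n → Γᵐᵒᵖ) i).unop
    have hd : ∀ {X : C} (u : X ⟶ ⨁ fun _ : Fin n => M) (j : Fin k),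
        (u ≫ d) ≫ biproduct.π _ j =
          ∑ i, (u ≫ biproduct.π _ i) ≫ c ((b j : Fin n → Γᵐᵒᵖ) i).unop := by
      intro X u j
      rw [Category.assoc, biproduct.matrix_π, biproduct.desc_eq, Preadditive.comp_sum]
      simp only [Category.assoc]
    have hfd : ∀ y : Y.obj, biproduct.lift (fun i => c (f i y)) ≫ d = 0 := by
      intro y
      refine biproduct.hom_ext _ _ fun j => ?_
      rw [hd, zero_comp]
      simp only [biproduct.lift_π, ← hc]
      rw [← map_sum, map_eq_zero_iff c c.injective]
      have := LinearMap.congr_fun (show Fintype.linearCombination Γᵐᵒᵖ f (b j) = 0 from (b j).2) y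
      rw [Fintype.linearCombination_apply, LinearMap.sum_apply] at this
      exact this
    let l : Y.obj →ₗ[Γ] homModule c hc (kernel d) :=
      { toFun := fun y => homModule.of c hc (kernel.lift d _ (hfd y))
        map_add' := fun x y => by
          change (kernel.lift d _ (hfd (x + y)) : M ⟶ kernel d) =
            kernel.lift d _ (hfd x) + kernel.lift d _ (hfd y)
          rw [← cancel_mono (kernel.ι d), Preadditive.add_comp]
          refine biproduct.hom_ext _ _ fun i => ?_
          rw [Preadditive.add_comp]
          simp
        map_smul' := fun γ y => by
          change kernel.lift d _ _ = c γ ≫ kernel.lift d _ _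
          rw [← cancel_mono (kernel.ι d)]
          refine biproduct.hom_ext _ _ fun i => ?_
          simp [hc] }
    have hl : Function.Bijective l := by
      have hπ : ∀ y i, ((show M ⟶ kernel d from l y) ≫ kernel.ι d) ≫ biproduct.π _ i =
          c (f i y) := by
        intro y i
        change (kernel.lift d _ (hfd y) ≫ _) ≫ _ = _
        rw [kernel.lift_ι, biproduct.lift_π]
      constructor
      · intro x y h
        refine hY.pi_injective hf (funext fun i => c.injective ?_)
        change c (f i x) = c (f i y)
        rw [← hπ, ← hπ, h]
      · intro u
        let u' : M ⟶ kernel d := u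
        let a : Fin n → Γ := fun i => c.symm ((u' ≫ kernel.ι d) ≫ biproduct.π _ i)
        have ha : LinearMap.ker (Fintype.linearCombination Γᵐᵒᵖ f) ≤
            LinearMap.ker (Fintype.linearCombination Γᵐᵒᵖ a) := by
          have : ⊤ ≤ LinearMap.ker (Fintype.linearCombination Γᵐᵒᵖ a ∘ₗ
              (LinearMap.ker (Fintype.linearCombination Γᵐᵒᵖ f)).subtype) := by
            rw [← hb, Submodule.span_le]
            rintro _ ⟨j, rfl⟩
            have h1 := hd (u' ≫ kernel.ι d) j
            rw [Category.assoc u', kernel.condition, comp_zero, zero_comp] at h1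
            change Fintype.linearCombination Γᵐᵒᵖ a (b j : Fin n → Γᵐᵒᵖ) = 0
            rw [Fintype.linearCombination_apply]
            apply c.injective
            rw [map_zero, h1, map_sum]
            refine Finset.sum_congr rfl fun i _ => ?_
            change c (a i * _) = _
            rw [hc, c.apply_symm_apply]
          intro x hx
          exact this (Submodule.mem_top (x := (⟨x, hx⟩ :
            LinearMap.ker (Fintype.linearCombination Γᵐᵒᵖ f))))
        obtain ⟨y, hy⟩ := hY.exists_of_relations hf a fun x hx => ha hx
        refine ⟨y, ?_⟩
        change (show M ⟶ kernel d from l y) = u'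
        rw [← cancel_mono (kernel.ι d)]
        refine biproduct.hom_ext _ _ fun i => ?_
        rw [hπ, hy, c.apply_symm_apply]
    exact ⟨kernel d, ⟨ObjectProperty.isoMk _ (LinearEquiv.ofBijective l hl).toModuleIso.symm⟩⟩⟩
  exact {}

end Reconstruction

theorem mainTheorem4 (Λ Γ : Type u) [Ring Λ] [Ring Γ]
    [IsNoetherianRing Λ] [IsNoetherianRing Λᵐᵒᵖ]
    [IsNoetherianRing Γ] [IsNoetherianRing Γᵐᵒᵖ]
    (hΛ : TwoSidedLNCondition Λ 2 2) :
    (Nonempty (Refl Λ ≌ Refl Γ) ↔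
      ∃ 𝒮 : ObjectProperty (ShortComplex (Refl Λ)), IsMaximumExactStructure 𝒮 ∧
        ∃ M : Refl Λ, IsGeneratorCogenerator 𝒮 M ∧
          Nonempty (Γ ≃+* (Module.End Λ M.obj)ᵐᵒᵖ)) ∧
    (Nonempty (Refl Λ ≌ Refl Γ) → TwoSidedLNCondition Γ 2 2) := by
  have hq := (isQuasiAbelian_refl_iff Λ).2 hΛ
  have := hq.hasKernels
  have := hq.hasCokernels
  refine ⟨⟨?_, ?_⟩, ?_⟩
  · rintro ⟨e⟩
    exact ⟨kernelCokernelPairs (Refl Λ), hq.isMaximumExactStructure, _,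
      isGeneratorCogenerator_inverse_obj e (ReflOver.unit Γ Γᵐᵒᵖ Γ)
        (exists_isStrictEpi (A := Γ) (B := Γᵐᵒᵖ) (E := Γ))
        (exists_isStrictEpi_op (A := Γ) (B := Γᵐᵒᵖ) (E := Γ)),
      nonempty_ringEquiv_end (A := Λ) (B := Λᵐᵒᵖ) (E := Λ) e⟩
  · rintro ⟨𝒮, h𝒮, M, hM, ⟨r⟩⟩
    let c : Γ ≃+ (M ⟶ M) :=
      { toFun := fun γ => ObjectProperty.homMk (ModuleCat.ofHom (r γ).unop)
        invFun := fun f => r.symm (MulOpposite.op f.hom.hom)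
        left_inv := fun γ => r.symm_apply_apply γ
        right_inv := fun f => by
          simp only [r.apply_symm_apply]
          rfl
        map_add' := fun a b => by
          simp only [map_add]
          rfl }
    have hc : ∀ a b, c (a * b) = c a ≫ c b := fun a b => by
      change ObjectProperty.homMk (ModuleCat.ofHom (r (a * b)).unop) = _
      rw [map_mul]
      rfl
    have := homFunctor_isEquivalence c hc (hM.isStableGenerator h𝒮.1)
      (hM.isStableGenerator_op h𝒮.1)
    exact ⟨(homFunctor c hc (hM.isStableGenerator h𝒮.1)
      (hM.isStableGenerator_op h𝒮.1)).asEquivalence⟩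
  · rintro ⟨e⟩
    exact (isQuasiAbelian_refl_iff Γ).1 (hq.of_equivalence e)
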